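/- **Setting.** Let $Q$ be a quiver whose arrow set is partitioned into $n+1$ nonempty parts (*arrow types*; $T$ is the set of types), $n\ge 0$. For a path $\gamma$ let $t_\gamma(a)$ be the number of its arrows of type $a$ and $\mathrm{ess}(\gamma)=\{a : t_\gamma(a)>0\}$; $\gamma$ is *admissible* if $t_\gamma(a)=0$ for some $a$, and *simple* if $t_\gamma(a)\le 1$ for all $a$. $Q$ is a $\mathbb Z^n$-*quiver* if exactly one arrow of each type leaves each vertex, each vertex is connected to each other by an admissible path, and two paths $\gamma_1,\gamma_2$ leaving the same vertex end at the same vertex iff $t_{\gamma_1}-t_{\gamma_2}$ is constant. Two distinct vertices joined by a simple path are *neighbors*; we write $v_2=I\cdot v_1$ if they are neighbors and $I$ is the essential type of a simple path from $v_1$ to $v_2$. Let $k$ be a field and $\mathfrak V=(V_v,\varphi)$ a representation of $Q$ in finite-dimensional $k$-vector spaces, $\varphi_\gamma$ being the composition of its maps along a path $\gamma$. It is a *linked net* if (1) $\varphi_{\gamma_1}$ is a scalar multiple of $\varphi_{\gamma_2}$ whenever $\gamma_1,\gamma_2$ connect the same two vertices and $\gamma_2$ is admissible; (2) $\varphi_\gamma=0$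 for each simple non-admissible path $\gamma$; (3) $\ker\varphi_{\gamma_1}\cap\ker\varphi_{\gamma_2}=0$ for admissible paths $\gamma_1,\gamma_2$ leaving the same vertex and having no arrow type in common. For vertices $u,w$ let $\varphi^u_w$ be $\varphi_\gamma$ for an admissible path $\gamma$ from $u$ to $w$ (well defined up to a nonzero scalar). $\mathfrak V$ is *exact* if $\mathrm{im}\,\varphi^{u}_{w}=\ker\varphi^{w}_{u}$ for all neighbors $u,w$; it is *nontrivial* if it is nonzero. For $m\in\mathbb N\cup\{\infty\}$, $\mathfrak V$ is $m$-*generated* by a set $S$ of vertices if for each vertex $v$ there are $l\le m$, $l\in\mathbb N$, vertices $w_1,\dots,w_l\in S$ and paths $\gamma_i$ from $w_i$ to $v$ such that $\bigoplus_i V_{w_i}\to V_v$ is surjective; it is *finitely generated* if it is $\infty$-generated by a finite set. Its *minimum set of generators* $H$ is the intersection of all sets of vertices that $1$-generate it (under the hypotheses below, $H$ is finite and all $V_v$ have the same dimension). **Polytopes.** For $\mu:2^H\to\mathbb R$ let $\mu^*(I)=\mu(H)-\mu(H\setminus I)$ and $$P_\mu=\{q\in\mathbb R^H : \mu(I)\le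 q(I)\le\mu^*(I)\ \text{for all } I\subseteq H\},\qquad q(I)=\sum_{u\in I}q(u).$$ For an $m$-*partition* $\pi=(\pi_1,\dots,\pi_m)$ of $H$ (pairwise disjoint nonempty sets with union $H$), put $F_i=\pi_1\cup\dots\cup\pi_i$ and $\mu_\pi(I)=\sum_{i=1}^m\big(\mu((I\cap F_i)\cup F_{i-1})-\mu(F_{i-1})\big)$. For a subspace $W\subseteq U:=\bigoplus_{u\in H}V_u$ let $\mu_W(I)=\dim\big(W\cap\bigoplus_{u\in I}V_u\big)$. Choose an admissible path $\gamma^v_u$ from $v$ to $u$ for all $u,v$, and for $v\in H$ let $W_v=\{(\varphi_{\gamma^v_u}(s))_{u\in H} : s\in V_v\}\subseteq U$, $\mu_v=\mu_{W_v}$, and $P_{v,\pi}=P_{(\mu_v)_\pi}$. Let $r+1$ be the dimension of the spaces $V_v$, $\Omega_{r+1}=\{q\in\mathbb R^H : q\ge0,\ q(H)=r+1\}$, and $\mathring\Omega_{r+1}$ its relative interior (the points on no proper face). **Polygons.** An $m$-*gon* is a set $\Delta$ of $m$ pairwise neighboring vertices ($m\ge1$). For each vertex $u$ of $Q$ there is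 a unique $w\in\Delta$, the *shadow* of $u$ in $\Delta$, such that for each $z\in\Delta$ some admissible path connects $z$ to $u$ through $w$; let $R^\Delta_w$ be the set of vertices with shadow $w$. Given $v\in\Delta$ there is a unique ordering $v=v_1,\dots,v_m$ of $\Delta$ forming an oriented $m$-gon, i.e. such that $v_{i+1}=I_i\cdot v_i$ $(1\le i<m)$ for some $m$-partition $(I_1,\dots,I_m)$ of $T$. The *ordered partition of $H$ induced by $\Delta$ and $v$* is $(R^\Delta_{v_1}\cap H,\dots,R^\Delta_{v_m}\cap H)$. For $\Delta\subseteq H$, let $V_\Delta=\bigoplus_{v\in\Delta}\bigcap_{w\in H\setminus R^\Delta_v}\ker\varphi^v_w$, let $W_\Delta\subseteq U$ be its image under $(s_v)_{v\in\Delta}\mapsto(\varphi_{\gamma^{w_u}_u}(s_{w_u}))_{u\in H}$, where $w_u$ is the shadow of $u$ in $\Delta$, and let $P_\Delta=P_{\mu_{W_\Delta}}$. **Proposition.** Let $\mathfrak V$ be a nontrivial exact finitely generated linked net of finite-dimensional vector spaces over a $\mathbb Z^n$-quiver $Q$, and let $H$ be its minimum set of generators. Then, for each $v\in H$ and each $m$-partition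 $\pi$ of $H$ such that $P_{v,\pi}\cap\mathring\Omega_{r+1}\ne\emptyset$, there is an $m$-gon $\Delta\subseteq H$ such that $v\in\Delta$ and the ordered partition of $H$ induced by $\Delta$ and $v$ is $\pi$; moreover $P_{v,\pi}=P_\Delta$. -/

import Mathlib

noncomputable section

namespace LinkedNet

/-! ### Ordered partitions, set functions and base polytopes -/

/-- `π = (π_1, …, π_m)` is an `m`-partition (a nontrivial ordered partition into `m` parts) of the
whole type `α`: the parts are nonempty, pairwise disjoint, and cover `α`. -/
structure IsOrderedPartition {α : Type*} {m : ℕ} (π : Fin m → Set α) : Prop where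
  nonempty : ∀ i, (π i).Nonempty
  disjoint : ∀ i j, i ≠ j → Disjoint (π i) (π j)
  cover : ∀ x, ∃ i, x ∈ π i

/-- `q(I) = ∑_{v ∈ I} q(v)` for `q ∈ ℝ^H` and `I ⊆ H`, with `H` finite. -/
def setSum {H : Type*} (q : H → ℝ) (I : Set H) : ℝ := ∑ᶠ v ∈ I, q v

/-- The adjoint function `μ^*(I) = μ(H) - μ(H - I)`. -/
def adjointFun {H : Type*} (μ : Set H → ℝ) (I : Set H) : ℝ := μ Set.univ - μ Iᶜ

/-- The base polytope `P_μ = {q ∈ ℝ^H | μ(I) ≤ q(I) ≤ μ^*(I) for each I ⊆ H}`. -/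
def basePolytope {H : Type*} (μ : Set H → ℝ) : Set (H → ℝ) :=
  {q | ∀ I : Set H, μ I ≤ setSum q I ∧ setSum q I ≤ adjointFun μ I}

/-- `μ_{J₂/J₁}(I) = μ((I ∩ J₂) ∪ J₁) - μ(J₁)`: restrict to `J₂` and contract `J₁`. -/
def minorFun {H : Type*} (μ : Set H → ℝ) (J₂ J₁ : Set H) (I : Set H) : ℝ :=
  μ ((I ∩ J₂) ∪ J₁) - μ J₁

/-- The splitting `μ_π = ∑_i μ_{F_i/F_{i-1}}` of `μ` with respect to an ordered partition `π`,
where `F_i = π_1 ∪ ⋯ ∪ π_i`. -/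
def splitting {H : Type*} {m : ℕ} (μ : Set H → ℝ) (π : Fin m → Set H) (I : Set H) : ℝ :=
  ∑ i : Fin m, minorFun μ (⋃ j ≤ i, π j) (⋃ j < i, π j) I

/-- The standard simplex `Ω_d = {q ∈ ℝ^H | q(v) ≥ 0 for all v, q(H) = d}`. -/
def simplex (H : Type*) (d : ℝ) : Set (H → ℝ) :=
  {q | (∀ v, 0 ≤ q v) ∧ setSum q Set.univ = d}

/-- The relative interior of a polytope: its points that lie on no proper face. -/
def relInterior {H : Type*} (P : Set (H → ℝ)) : Set (H → ℝ) :=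
  {q | q ∈ P ∧ ∀ F : Set (H → ℝ), IsExposed ℝ P F → F ≠ P → q ∉ F}

/-- For a subspace `W` of `U = ⨁_{v ∈ H} U_v`, with `H` finite, the function
`μ_W(I) = dim (W ∩ U_I)`, where `U_I ⊆ U` consists of the vectors supported on `I`. -/
def subspaceFun {k H : Type*} [Field k] {U : H → Type*} [∀ v, AddCommGroup (U v)]
    [∀ v, Module k (U v)] (W : Submodule k (∀ v, U v)) (I : Set H) : ℝ :=
  Module.finrank k ↥(W ⊓ (⨅ v ∈ Iᶜ, LinearMap.ker (LinearMap.proj v)) : Submodule k (∀ v, U v))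

/-! ### `ℤ^n`-quivers

The partition of the arrows of a quiver `Q` into `n + 1` arrow types is given by the function `ty`
that sends each arrow to its type. -/

section ZnQuiver

variable {n : ℕ} {Q : Type*} [Quiver Q] (ty : ∀ ⦃u v : Q⦄, (u ⟶ v) → Fin (n + 1))

/-- The number of arrows of type `a` in a path. -/
def typeCount (a : Fin (n + 1)) {u : Q} : ∀ {v : Q}, Quiver.Path u v → ℕ
  | _, .nil => 0
  | _, .cons p e => typeCount a p + if ty e = a then 1 else 0

/-- The essential type of a path: the set of arrow types that occur in it. -/
def ess {u v : Q} (p : Quiver.Path u v) : Set (Fin (n + 1)) := {a | 0 < typeCount ty a p}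

/-- A path is admissible if some arrow type does not occur in it. -/
def Admissible {u v : Q} (p : Quiver.Path u v) : Prop := ∃ a, typeCount ty a p = 0

/-- A path is simple if each arrow type occurs in it at most once. -/
def SimplePath {u v : Q} (p : Quiver.Path u v) : Prop := ∀ a, typeCount ty a p ≤ 1

/-- `Q`, with the given arrow types, is a `ℤ^n`-quiver. -/
structure IsZnQuiver : Prop where
  type_nonempty : ∀ a, ∃ (u v : Q) (e : u ⟶ v), ty e = a
  existsUnique_arrow : ∀ (u : Q) (a : Fin (n + 1)), ∃! e : (Σ' v : Q, u ⟶ v), ty e.2 = a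
  connected : ∀ u v : Q, ∃ p : Quiver.Path u v, Admissible ty p
  same_end_iff : ∀ (u v w : Q) (p : Quiver.Path u v) (q : Quiver.Path u w),
    v = w ↔ ∃ c : ℤ, ∀ a, (typeCount ty a p : ℤ) - (typeCount ty a q : ℤ) = c

/-- Two distinct vertices are neighbors if a simple path connects the first to the second (then one
connects the second to the first, in a `ℤ^n`-quiver). -/
def Neighbor (u v : Q) : Prop := u ≠ v ∧ ∃ p : Quiver.Path u v, SimplePath ty p

/-- A polygon: a finite nonempty collection of pairwise neighboring vertices. -/
def IsPolygon (Δ : Finset Q) : Prop :=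
  Δ.Nonempty ∧ ∀ u ∈ Δ, ∀ v ∈ Δ, u ≠ v → Neighbor ty u v

/-- An `m`-gon: a polygon with `m` vertices. -/
def IsGon (m : ℕ) (Δ : Finset Q) : Prop := IsPolygon ty Δ ∧ Δ.card = m

/-- `v_2 = I · v_1`: the vertices are neighbors and `I` is the essential type of a simple path that
connects `v_1` to `v_2`. -/
def IsStep (I : Set (Fin (n + 1))) (v₁ v₂ : Q) : Prop :=
  v₁ ≠ v₂ ∧ ∃ p : Quiver.Path v₁ v₂, SimplePath ty p ∧ ess ty p = I

/-- `v_1, …, v_m` form an oriented `m`-gon: for some `m`-partition `I_1, …, I_m` of the set of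
arrow types, `v_{i+1} = I_i · v_i` for `i = 1, …, m - 1`. -/
def IsOrientedGon {m : ℕ} (w : Fin m → Q) : Prop :=
  ∃ I : Fin m → Set (Fin (n + 1)), IsOrderedPartition I ∧
    ∀ i j : Fin m, (i : ℕ) + 1 = j → IsStep ty (I i) (w i) (w j)

/-- `w` is the shadow of `u` in `S` (with `S` equal to its hull): `w ∈ S`, and for every `z ∈ S`
some admissible path connects `z` to `u` through `w`. -/
def IsShadow (S : Set Q) (u w : Q) : Prop :=
  w ∈ S ∧ ∀ z ∈ S, ∃ (p : Quiver.Path z w) (q : Quiver.Path w u), Admissible ty (p.comp q)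

/-- The shadow region `R_v^S`: the vertices whose shadow in `S` is `v`. -/
def shadowRegion (S : Set Q) (v : Q) : Set Q := {u | IsShadow ty S u v}

open Classical in
/-- The shadow of `u` in `S`, as a function of `u`. It exists and is unique when `S` is a polygon;
the value `u` where there is no shadow is never used then. -/
def shadow (S : Set Q) (u : Q) : Q := if h : ∃ w, IsShadow ty S u w then h.choose else u

/-- `π` is the ordered partition of `H` induced by the `m`-gon `Δ` and its vertex `v`: for the
ordering `v = v_1, …, v_m` of `Δ` that forms an oriented `m`-gon, `π_i = R_{v_i}^Δ ∩ H`. -/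
def IsInducedPartition (Δ : Finset Q) (v : Q) (H : Set Q) {m : ℕ} (π : Fin m → Set H) : Prop :=
  ∃ w : Fin m → Q, IsOrientedGon ty w ∧ Set.range w = (Δ : Set Q) ∧ Function.Injective w ∧
    (∃ h : 0 < m, w ⟨0, h⟩ = v) ∧
    ∀ i, π i = {u : H | (u : Q) ∈ shadowRegion ty (Δ : Set Q) (w i)}

end ZnQuiver

/-! ### Linked nets of vector spaces

A representation of `Q` is a family of vector spaces `V v` with a linear map `φ e` for each
arrow `e`. -/

section Representations

variable {k : Type*} [Field k] {Q : Type*} [Quiver Q] {V : Q → Type*}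
  [∀ v, AddCommGroup (V v)] [∀ v, Module k (V v)]
  (φ : ∀ ⦃u v : Q⦄, (u ⟶ v) → V u →ₗ[k] V v)

/-- The composition `φ_γ` of the maps along a path `γ`; the identity for a trivial path. -/
def pathMap {u : Q} : ∀ {v : Q}, Quiver.Path u v → (V u →ₗ[k] V v)
  | _, .nil => LinearMap.id
  | _, .cons p e => (φ e).comp (pathMap p)

/-- The representation is `m`-generated by `S`: for each vertex `v` there are `w_1, …, w_l ∈ S`
with `l ≤ m`, and paths `γ_i` from `w_i` to `v`, such that `⨁ V_{w_i} → V_v` is surjective. -/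
def GeneratedBy (m : ℕ∞) (S : Set Q) : Prop :=
  ∀ v : Q, ∃ l : ℕ, (l : ℕ∞) ≤ m ∧ ∃ w : Fin l → Q, (∀ i, w i ∈ S) ∧
    ∃ γ : ∀ i, Quiver.Path (w i) v,
      ∀ x : V v, ∃ s : ∀ i, V (w i), ∑ i, pathMap φ (γ i) (s i) = x

/-- The representation is `∞`-generated by a finite set of vertices. -/
def FinitelyGenerated : Prop := ∃ S : Set Q, S.Finite ∧ GeneratedBy φ ⊤ S

/-- The minimum set of generators: the intersection of all `1`-generating sets of vertices. -/
def minGenerators : Set Q := ⋂₀ {S : Set Q | GeneratedBy φ 1 S}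

section Nets

variable {n : ℕ} (ty : ∀ ⦃u v : Q⦄, (u ⟶ v) → Fin (n + 1))

/-- The representation is a linked net. -/
structure IsLinkedNet : Prop where
  smul_of_admissible : ∀ (u v : Q) (p q : Quiver.Path u v), Admissible ty q →
    ∃ c : k, pathMap φ p = c • pathMap φ q
  minimal_circuit : ∀ (u v : Q) (p : Quiver.Path u v), SimplePath ty p → ¬ Admissible ty p →
    pathMap φ p = 0
  ker_inf_ker : ∀ (u v w : Q) (p : Quiver.Path u v) (q : Quiver.Path u w),
    Admissible ty p → Admissible ty q → Disjoint (ess ty p) (ess ty q) →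
    LinearMap.ker (pathMap φ p) ⊓ LinearMap.ker (pathMap φ q) = ⊥

/-- Exactness: `im φ^{u₁}_{u₂} = ker φ^{u₂}_{u₁}` for neighbors `u₁`, `u₂`. -/
def IsExact : Prop :=
  ∀ u₁ u₂ : Q, Neighbor ty u₁ u₂ → ∀ (p : Quiver.Path u₁ u₂) (q : Quiver.Path u₂ u₁),
    Admissible ty p → Admissible ty q →
    LinearMap.range (pathMap φ p) = LinearMap.ker (pathMap φ q)

/-! In what follows, `γ u v` is a chosen admissible path from `u` to `v`. -/

variable (γ : ∀ u v : Q, Quiver.Path u v) (H : Set Q)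

/-- The map `Ψ^v_H : V_v → U = ⨁_{u ∈ H} V_u`, `s ↦ (φ_{γ^v_u}(s) | u ∈ H)`. -/
def psi (v : Q) : V v →ₗ[k] (∀ u : H, V u) :=
  LinearMap.pi fun u : H => pathMap φ (γ v u)

/-- The subspace `W_v = Ψ^v_H(V_v)` of `U`. -/
def vertexSpace (v : Q) : Submodule k (∀ u : H, V u) := LinearMap.range (psi φ γ H v)

/-- `P_{v,π}`: the face of `P_v` that corresponds to `π`, i.e. the base polytope of the splitting
`μ_{v,π}` of the function `μ_v` of `W_v`. -/
def vertexFace {m : ℕ} (v : Q) (π : Fin m → Set H) : Set (H → ℝ) :=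
  basePolytope (splitting (subspaceFun (vertexSpace φ γ H v)) π)

/-- `V_Δ = ⨁_{v ∈ Δ} ⋂_{w ∈ H - R_v^Δ} ker φ^v_w`, as the space of the families of vectors that
are supported on `Δ` and have component at each `v ∈ Δ` in the intersection of the kernels. -/
def polygonSource (Δ : Finset Q) : Submodule k (∀ v : Q, V v) where
  carrier := {s | (∀ v, v ∉ Δ → s v = 0) ∧
    ∀ v ∈ Δ, ∀ w ∈ H, w ∉ shadowRegion ty (Δ : Set Q) v → pathMap φ (γ v w) (s v) = 0}
  add_mem' := by
    rintro a b ⟨ha, ha'⟩ ⟨hb, hb'⟩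
    refine ⟨fun v hv => by simp [ha v hv, hb v hv], fun v hv w hw hwv => ?_⟩
    simp [ha' v hv w hw hwv, hb' v hv w hw hwv]
  zero_mem' := by simp
  smul_mem' := by
    rintro c a ⟨ha, ha'⟩
    refine ⟨fun v hv => by simp [ha v hv], fun v hv w hw hwv => ?_⟩
    simp [ha' v hv w hw hwv]

/-- The map `Ψ^Δ_H`, `(s_v | v ∈ Δ) ↦ (φ^{w_u}_u(s_{w_u}) | u ∈ H)`, where `w_u` is the shadow
of `u` in `Δ`. -/
def polygonMap (Δ : Finset Q) : (∀ v : Q, V v) →ₗ[k] (∀ u : H, V u) :=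
  LinearMap.pi fun u : H =>
    (pathMap φ (γ (shadow ty (Δ : Set Q) u) u)).comp
      (LinearMap.proj (shadow ty (Δ : Set Q) (u : Q)))

/-- `W_Δ = Ψ^Δ_H(V_Δ)`. -/
def polygonSpace (Δ : Finset Q) : Submodule k (∀ u : H, V u) :=
  (polygonSource φ ty γ H Δ).map (polygonMap φ ty γ H Δ)

/-- `P_Δ`: the base polytope of the function of `W_Δ`. -/
def polygonPolytope (Δ : Finset Q) : Set (H → ℝ) :=
  basePolytope (subspaceFun (polygonSpace φ ty γ H Δ))

end Nets

end Representations

end LinkedNet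

end

/-!
Write `typeVec u v` for the type of an admissible path from `u` to `v`. In a linked net, a
composition along a non-admissible path vanishes (`IsLinkedNet.pathMap_eq_zero`), and the kernel of
the map along an admissible path depends only on its essential type, increasing with it and turning
intersections of essential types into intersections of kernels
(`IsLinkedNet.apply_eq_zero_of_subset`, `IsLinkedNet.apply_eq_zero_of_iInter`).

Let `q` be a point of `P_{v,π}` in the interior of the simplex. All its coordinates are positive,
whereas for `u ∈ π i` the coordinate `q u` is at most the drop in dimension from the space of vectors
at `v` that vanish on the blocks after `π i` to its subspace of those that vanish at `u` too. So some
vector at `v` vanishes on all blocks after `π i` but not at `u` (`exists_apply_ne_zero`). Let `J i`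
be the set of types common to all paths from `v` to the blocks from `π i` on. By the description of
kernels, `J i` is contained in the essential type of the path from `v` to `u ∈ π i`, but `J (i + 1)`
is not. Hence the `J i` strictly increase from the empty set, and the vertices `w i = J i · v` form
an oriented polygon starting at `v`; the shadow of `u` in it is the last `w i` with `J i` contained
in the essential type of the path from `v` to `u`, so that it induces `π`
(`IsFlagPolygon.isOrientedGon`, `IsFlagPolygon.mem_shadowRegion_iff`).

The separating vectors and exactness show that the map from `w i` to each vertex of `H` is nonzero.
As `H` itself `1`-generates, some `u ∈ H` generates `w i`; were `u ≠ w i`, the map from `w i` to `u`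
would vanish. So `w i ∈ H` (`IsFlagPolygon.mem_minGenerators`). That `H` is finite and `1`-generates
follows from finite generation: the tropical projections of all vertices to a finite generating set
form a finite `1`-generating set (`IsLinkedNet.exists_finite_surjective`), in which each vertex has
a maximal generator.

Finally, `μ_{v,π}` and the function of `W_Δ` coincide. By exactness, the summand of `V_Δ` at `w i` is
the image of the vectors at `v` that vanish after `π i`, and the kernel of `V v → V (w i)` consists
of those that vanish from `π i` on; so both functions are the sum over `i` of the dimensions of the
same subspaces of the `V (w i)` (`IsFlagPolygon.splitting_eq`,
`IsFlagPolygon.subspaceFun_polygonSpace`).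
-/

namespace LinkedNet

/-! ### Paths in a `ℤ^n`-quiver -/

section Quivers

variable {n : ℕ} {Q : Type*} [Quiver Q] {ty : ∀ ⦃u v : Q⦄, (u ⟶ v) → Fin (n + 1)}

lemma typeCount_comp (a : Fin (n + 1)) {u v w : Q} (p : Quiver.Path u v) (q : Quiver.Path v w) :
    typeCount ty a (p.comp q) = typeCount ty a p + typeCount ty a q := by
  induction q with
  | nil => simp [typeCount]
  | cons q e ih => simp [typeCount, ih, add_assoc]

lemma IsZnQuiver.exists_path (hQ : IsZnQuiver ty) (u : Q) (t : Fin (n + 1) → ℕ) :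
    ∃ (v : Q) (p : Quiver.Path u v), ∀ a, typeCount ty a p = t a := by
  induction hN : ∑ a, t a generalizing t with
  | zero =>
    refine ⟨u, .nil, fun a => ?_⟩
    simp only [Finset.sum_eq_zero_iff, Finset.mem_univ, true_implies] at hN
    simp [typeCount, hN a]
  | succ N ih =>
    obtain ⟨a, ha⟩ : ∃ a, t a ≠ 0 := by
      by_contra! h
      simp [h] at hN
    have ht : ∀ b, t b = Function.update t a (t a - 1) b + if a = b then 1 else 0 := by
      intro b
      rcases eq_or_ne a b with rfl | hb
      · simp; omega
      · simp [hb, Function.update_of_ne hb.symm]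
    have hsum : ∑ b, Function.update t a (t a - 1) b = N := by
      have : ∑ b, t b = ∑ b, Function.update t a (t a - 1) b + 1 :=
        (Finset.sum_congr rfl fun b _ => ht b).trans (by rw [Finset.sum_add_distrib]; simp)
      omega
    obtain ⟨v, p, hp⟩ := ih _ hsum
    obtain ⟨⟨w, e⟩, he, -⟩ := hQ.existsUnique_arrow v a
    refine ⟨w, p.cons e, fun b => ?_⟩
    have he : ty e = a := he
    rw [ht b, typeCount, hp, he]

/-- The type of the chosen path from `u` to `v`. As that path is admissible, this is the
displacement from `u` to `v` in `ℤ^{n+1}` modulo the diagonal, normalized to have minimum `0`. -/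
def typeVec (ty : ∀ ⦃u v : Q⦄, (u ⟶ v) → Fin (n + 1)) (γ : ∀ u v : Q, Quiver.Path u v) (u v : Q)
    (a : Fin (n + 1)) : ℕ := typeCount ty a (γ u v)

/-- The vertex `v` lies between `u` and `w`: the chosen paths from `u` to `v` and from `v` to `w`
compose to an admissible path. -/
def Between (ty : ∀ ⦃u v : Q⦄, (u ⟶ v) → Fin (n + 1)) (γ : ∀ u v : Q, Quiver.Path u v)
    (u v w : Q) : Prop := ∃ a, typeVec ty γ u v a = 0 ∧ typeVec ty γ v w a = 0

variable {γ : ∀ u v : Q, Quiver.Path u v}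

lemma Between.admissible_comp {u v w : Q} (h : Between ty γ u v w) :
    Admissible ty ((γ u v).comp (γ v w)) := by
  obtain ⟨a, h₁, h₂⟩ := h
  simp only [typeVec] at h₁ h₂
  exact ⟨a, by rw [typeCount_comp]; omega⟩

lemma typeCount_eq_typeVec_add (hQ : IsZnQuiver ty) (hγ : ∀ u v, Admissible ty (γ u v)) {u v : Q}
    (p : Quiver.Path u v) : ∃ c : ℕ, ∀ a, typeCount ty a p = typeVec ty γ u v a + c := by
  obtain ⟨c, hc⟩ := (hQ.same_end_iff u v v p (γ u v)).1 rfl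
  obtain ⟨b, hb⟩ := hγ u v
  refine ⟨c.toNat, fun a => ?_⟩
  have h₁ := hc a
  have h₂ := hc b
  simp only [typeVec]
  omega

lemma typeCount_eq_typeVec (hQ : IsZnQuiver ty) (hγ : ∀ u v, Admissible ty (γ u v)) {u v : Q}
    {p : Quiver.Path u v} (hp : Admissible ty p) (a : Fin (n + 1)) :
    typeCount ty a p = typeVec ty γ u v a := by
  obtain ⟨c, hc⟩ := typeCount_eq_typeVec_add hQ hγ p
  obtain ⟨b, hb⟩ := hp
  have h₁ := hc a
  have h₂ := hc b
  omega

lemma typeVec_self (hQ : IsZnQuiver ty) (hγ : ∀ u v, Admissible ty (γ u v)) (u : Q)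
    (a : Fin (n + 1)) : typeVec ty γ u u a = 0 :=
  (typeCount_eq_typeVec hQ hγ (p := (.nil : Quiver.Path u u)) ⟨0, rfl⟩ a).symm

lemma eq_of_typeVec_eq (hQ : IsZnQuiver ty) {u v w : Q}
    (h : ∀ a, typeVec ty γ u v a = typeVec ty γ u w a) : v = w :=
  (hQ.same_end_iff u v w (γ u v) (γ u w)).2 ⟨0, fun a => by
    have := h a
    simp only [typeVec] at this
    omega⟩

lemma exists_typeVec_eq (hQ : IsZnQuiver ty) (hγ : ∀ u v, Admissible ty (γ u v)) (u : Q)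
    {t : Fin (n + 1) → ℕ} (ht : ∃ a, t a = 0) : ∃ v, ∀ a, typeVec ty γ u v a = t a := by
  obtain ⟨v, p, hp⟩ := hQ.exists_path u t
  obtain ⟨b, hb⟩ := ht
  exact ⟨v, fun a => by rw [← typeCount_eq_typeVec hQ hγ ⟨b, (hp b).trans hb⟩, hp]⟩

lemma typeVec_add (hQ : IsZnQuiver ty) (hγ : ∀ u v, Admissible ty (γ u v)) (u v w : Q) :
    ∃ c : ℕ, ∀ a, typeVec ty γ u v a + typeVec ty γ v w a = typeVec ty γ u w a + c := by
  obtain ⟨c, hc⟩ := typeCount_eq_typeVec_add hQ hγ ((γ u v).comp (γ v w))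
  exact ⟨c, fun a => by rw [← hc, typeCount_comp]; rfl⟩

lemma Between.typeVec_add (hQ : IsZnQuiver ty) (hγ : ∀ u v, Admissible ty (γ u v)) {u v w : Q}
    (h : Between ty γ u v w) (a : Fin (n + 1)) :
    typeVec ty γ u v a + typeVec ty γ v w a = typeVec ty γ u w a := by
  obtain ⟨c, hc⟩ := LinkedNet.typeVec_add hQ hγ u v w
  obtain ⟨b, h₁, h₂⟩ := h
  have := hc a
  have := hc b
  omega

/-- A displacement is determined by its class modulo the diagonal and its minimum being `0`. -/
lemma typeVec_eq_of_sub (hQ : IsZnQuiver ty) (hγ : ∀ u v, Admissible ty (γ u v)) {u v w : Q}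
    {t : Fin (n + 1) → ℕ} (ht : ∃ a, t a = 0) (c : ℤ)
    (h : ∀ a, (typeVec ty γ u w a : ℤ) - typeVec ty γ u v a = t a + c) (a : Fin (n + 1)) :
    typeVec ty γ v w a = t a := by
  obtain ⟨d, hd⟩ := typeVec_add hQ hγ u v w
  obtain ⟨x, hx⟩ := ht
  obtain ⟨y, hy⟩ := hγ v w
  change typeVec ty γ v w y = 0 at hy
  have := h a; have := h x; have := h y; have := hd a; have := hd x; have := hd y
  omega

lemma between_of_typeVec_le (hQ : IsZnQuiver ty)
    (hγ : ∀ u v, Admissible ty (γ u v)) {u x y : Q}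
    (h : ∀ a, typeVec ty γ u x a ≤ typeVec ty γ u y a) : Between ty γ u x y := by
  obtain ⟨b, hb⟩ : ∃ b, typeVec ty γ u y b = 0 := hγ u y
  have := typeVec_eq_of_sub hQ hγ (u := u) (v := x) (w := y)
    (t := fun a => typeVec ty γ u y a - typeVec ty γ u x a) ⟨b, by simp [hb]⟩ 0
    (fun a => by have := h a; omega) b
  exact ⟨b, by have := h b; omega, by rw [this, hb, Nat.zero_sub]⟩

lemma between_self_iff (hQ : IsZnQuiver ty) (hγ : ∀ u v, Admissible ty (γ u v)) {u v : Q} :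
    Between ty γ u v u ↔ u = v := by
  refine ⟨fun h => ?_, ?_⟩
  · refine eq_of_typeVec_eq (u := u) (γ := γ) hQ fun a => ?_
    have := h.typeVec_add hQ hγ a
    have := typeVec_self hQ hγ u a
    omega
  · rintro rfl
    exact ⟨0, typeVec_self hQ hγ u 0, typeVec_self hQ hγ u 0⟩

lemma neighbor_of_typeVec_le_one {u v : Q} (huv : u ≠ v) (h : ∀ a, typeVec ty γ u v a ≤ 1) :
    Neighbor ty u v := ⟨huv, γ u v, h⟩

/-- Shadows are vertices of `S` between every vertex of `S` and `u`. -/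
lemma isShadow_iff (hQ : IsZnQuiver ty) (hγ : ∀ u v, Admissible ty (γ u v)) {S : Set Q} {u w : Q} :
    IsShadow ty S u w ↔ w ∈ S ∧ ∀ z ∈ S, Between ty γ z w u := by
  refine and_congr_right fun _ => forall₂_congr fun z _ => ⟨?_, fun h => ⟨_, _, h.admissible_comp⟩⟩
  rintro ⟨p, q, a, ha⟩
  rw [typeCount_comp] at ha
  obtain ⟨c, hc⟩ := typeCount_eq_typeVec_add hQ hγ p
  obtain ⟨d, hd⟩ := typeCount_eq_typeVec_add hQ hγ q
  have := hc a; have := hd a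
  exact ⟨a, by omega, by omega⟩

lemma IsShadow.unique (hQ : IsZnQuiver ty) (hγ : ∀ u v, Admissible ty (γ u v)) {S : Set Q}
    {u w w' : Q} (h : IsShadow ty S u w) (h' : IsShadow ty S u w') : w = w' := by
  rw [isShadow_iff hQ hγ] at h h'
  refine eq_of_typeVec_eq (γ := γ) (u := w) hQ fun a => ?_
  have h₁ := (h.2 w' h'.1).typeVec_add hQ hγ a
  have h₂ := (h'.2 w h.1).typeVec_add hQ hγ a
  rw [typeVec_self hQ hγ]
  omega

lemma shadow_eq (hQ : IsZnQuiver ty) (hγ : ∀ u v, Admissible ty (γ u v)) {S : Set Q} {u w : Q}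
    (h : IsShadow ty S u w) : shadow ty S u = w := by
  have hex : ∃ w, IsShadow ty S u w := ⟨w, h⟩
  rw [shadow, dif_pos hex]
  exact hex.choose_spec.unique hQ hγ h

/-- The tropical projection of `v` to a finite set `S`: the vertex `w` whose displacement to `v`
is the coordinatewise minimum of those from `S`. Each coordinate of `typeVec z w` vanishes for some
`z ∈ S`; this confines `w` to a bounded region that does not depend on `v`. -/
lemma exists_between_of_finset (hQ : IsZnQuiver ty) (hγ : ∀ u v, Admissible ty (γ u v))
    {S : Finset Q} (hS : S.Nonempty) (v : Q) :
    ∃ w, (∀ z ∈ S, Between ty γ z w v) ∧ ∀ a, ∃ z ∈ S, typeVec ty γ z w a = 0 := by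
  obtain ⟨z₀, hz₀⟩ := hS
  let t : Fin (n + 1) → ℕ := fun a => S.inf' ⟨z₀, hz₀⟩ fun z => typeVec ty γ z v a
  have hle : ∀ z ∈ S, ∀ a, t a ≤ typeVec ty γ z v a := fun z hz a =>
    Finset.inf'_le (fun z => typeVec ty γ z v a) hz
  have hadm : ∀ z, ∃ a, typeVec ty γ z v a = 0 := fun z => hγ z v
  -- A path of type `typeVec z₀ v - t` from `z₀` ends at the required vertex.
  obtain ⟨b, hb⟩ := hadm z₀
  obtain ⟨w, hw⟩ := exists_typeVec_eq hQ hγ z₀ (t := fun a => typeVec ty γ z₀ v a - t a)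
    ⟨b, by have := hle z₀ hz₀ b; omega⟩
  have hwv : ∀ a, typeVec ty γ w v a = t a := by
    refine typeVec_eq_of_sub hQ hγ (u := z₀) ⟨b, by have := hle z₀ hz₀ b; omega⟩ 0 fun a => ?_
    have := hw a; have := hle z₀ hz₀ a
    omega
  have hzw : ∀ z ∈ S, ∀ a, typeVec ty γ z w a = typeVec ty γ z v a - t a := by
    intro z hz
    obtain ⟨c, hc⟩ := typeVec_add hQ hγ z w v
    obtain ⟨x, hx⟩ := hadm z
    obtain ⟨y, hy⟩ := hγ z w
    change typeVec ty γ z w y = 0 at hy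
    intro a
    have := hc a; have := hc x; have := hc y; have := hle z hz a; have := hle z hz x
    have := hle z hz y; have := hwv a; have := hwv x; have := hwv y
    omega
  refine ⟨w, fun z hz => ?_, fun a => ?_⟩
  · obtain ⟨x, hx⟩ := hadm z
    have := hle z hz x
    exact ⟨x, by rw [hzw z hz]; omega, by rw [hwv]; omega⟩
  · obtain ⟨z, hz, hza⟩ := Finset.exists_mem_eq_inf' ⟨z₀, hz₀⟩ fun z => typeVec ty γ z v a
    refine ⟨z, hz, ?_⟩
    rw [hzw z hz, ← hza]
    exact Nat.sub_self _

/-- The tropical projections to a nonempty finite set `S` form a finite set: they all lie in a box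
around a vertex of `S`. -/
lemma exists_finite_between (hQ : IsZnQuiver ty) (hγ : ∀ u v, Admissible ty (γ u v))
    {S : Finset Q} (hS : S.Nonempty) :
    ∃ P : Set Q, P.Finite ∧ ∀ v, ∃ w ∈ P, ∀ z ∈ S, Between ty γ z w v := by
  obtain ⟨z₀, hz₀⟩ := id hS
  let M : Fin (n + 1) → ℕ := fun a => S.sup fun z => typeVec ty γ z₀ z a
  refine ⟨{w | typeVec ty γ z₀ w ≤ M}, ?_, fun v => ?_⟩
  · exact Set.Finite.preimage (fun x _ y _ hxy => eq_of_typeVec_eq hQ (congrFun hxy))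
      (Set.finite_Iic M)
  · obtain ⟨w, hw, hw'⟩ := exists_between_of_finset hQ hγ hS v
    refine ⟨w, fun a => ?_, hw⟩
    obtain ⟨z, hz, hza⟩ := hw' a
    obtain ⟨c, hc⟩ := typeVec_add hQ hγ z₀ z w
    have : typeVec ty γ z₀ z a ≤ M a := Finset.le_sup (f := fun z => typeVec ty γ z₀ z a) hz
    have := hc a
    change typeVec ty γ z₀ w a ≤ M a
    omega

end Quivers

/-! ### Maps along paths in a linked net -/

section Nets

variable {n : ℕ} {Q : Type*} [Quiver Q] {ty : ∀ ⦃u v : Q⦄, (u ⟶ v) → Fin (n + 1)}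
  {k : Type*} [Field k] {V : Q → Type*} [∀ v, AddCommGroup (V v)] [∀ v, Module k (V v)]
  {φ : ∀ ⦃u v : Q⦄, (u ⟶ v) → V u →ₗ[k] V v} {γ : ∀ u v : Q, Quiver.Path u v}

lemma pathMap_comp {u v w : Q} (p : Quiver.Path u v) (q : Quiver.Path v w) :
    pathMap φ (p.comp q) = (pathMap φ q).comp (pathMap φ p) := by
  induction q with
  | nil => rfl
  | cons q e ih => simp [pathMap, ih, LinearMap.comp_assoc]

/-- Maps along non-admissible paths vanish: by rescaling, the part of the path up to the arrow that
completes the set of types can be rearranged to end in a minimal circuit. -/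
lemma IsLinkedNet.pathMap_eq_zero (hnet : IsLinkedNet φ ty) (hQ : IsZnQuiver ty) {u v : Q}
    (p : Quiver.Path u v) (hp : ¬ Admissible ty p) : pathMap φ p = 0 := by
  induction p with
  | nil => exact absurd ⟨0, rfl⟩ hp
  | @cons z z' p e ih =>
    by_cases hp' : Admissible ty p
    swap
    · simp [pathMap, ih hp']
    obtain ⟨a, ha⟩ := id hp'
    simp only [Admissible, not_exists, typeCount] at hp
    have hea : ty e = a := by
      by_contra h
      exact hp a (by simp [ha, h])
    have hpos : ∀ b, b ≠ a → 0 < typeCount ty b p := by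
      intro b hb
      have := hp b
      rw [if_neg (by rw [hea]; exact hb.symm)] at this
      omega
    obtain ⟨x, q, hq⟩ := hQ.exists_path u fun b => typeCount ty b p - if b = a then 0 else 1
    obtain ⟨y, q', hq'⟩ := hQ.exists_path x fun b => if b = a then 0 else 1
    have htype : ∀ b, typeCount ty b (q.comp q') = typeCount ty b p := by
      intro b
      rw [typeCount_comp, hq, hq']
      by_cases hb : b = a
      · simp [hb]
      · have := hpos b hb
        simp only [hb, if_false]
        omega
    obtain rfl : y = z :=
      (hQ.same_end_iff u y z (q.comp q') p).2 ⟨0, fun b => by rw [htype b]; omega⟩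
    obtain ⟨c, hc⟩ := hnet.smul_of_admissible u y p (q.comp q') ⟨a, by rw [htype, ha]⟩
    have hzero : pathMap φ (q'.cons e) = 0 := by
      refine hnet.minimal_circuit _ _ _ (fun b => ?_) ?_
      · rw [typeCount, hq', hea]
        by_cases hb : b = a
        · simp [hb]
        · simp [hb, Ne.symm hb]
      · rintro ⟨b, hb⟩
        rw [typeCount, hq', hea] at hb
        by_cases hba : b = a
        · simp [hba] at hb
        · simp [hba] at hb
    rw [pathMap, hc, pathMap_comp, LinearMap.comp_smul, ← LinearMap.comp_assoc]
    change c • (pathMap φ (q'.cons e)).comp _ = 0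
    rw [hzero, LinearMap.zero_comp, smul_zero]

/-- The map of the composite path through `v` and that of the chosen path are multiples of each
other, so they have the same kernel. -/
lemma IsLinkedNet.comp_eq_zero_iff (hnet : IsLinkedNet φ ty) (hγ : ∀ u v, Admissible ty (γ u v))
    {u v w : Q} (h : Between ty γ u v w) (s : V u) :
    pathMap φ (γ v w) (pathMap φ (γ u v) s) = 0 ↔ pathMap φ (γ u w) s = 0 := by
  rw [← LinearMap.comp_apply, ← pathMap_comp]
  obtain ⟨c, hc⟩ := hnet.smul_of_admissible u w _ _ h.admissible_comp
  obtain ⟨d, hd⟩ := hnet.smul_of_admissible u w _ _ (hγ u w)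
  exact ⟨fun hs => by rw [hc, LinearMap.smul_apply, hs, smul_zero],
    fun hs => by rw [hd, LinearMap.smul_apply, hs, smul_zero]⟩

lemma IsLinkedNet.range_le (hnet : IsLinkedNet φ ty) {u v w : Q} (h : Between ty γ u v w) :
    LinearMap.range (pathMap φ (γ u w)) ≤ LinearMap.range (pathMap φ (γ v w)) := by
  obtain ⟨c, hc⟩ := hnet.smul_of_admissible u w (γ u w) _ h.admissible_comp
  rintro _ ⟨s, rfl⟩
  refine ⟨c • pathMap φ (γ u v) s, ?_⟩
  rw [hc, pathMap_comp]
  simp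

lemma IsLinkedNet.comp_eq_zero (hnet : IsLinkedNet φ ty) (hQ : IsZnQuiver ty) {u v w : Q}
    (h : ¬ Between ty γ u v w) (s : V u) : pathMap φ (γ v w) (pathMap φ (γ u v) s) = 0 := by
  rw [← LinearMap.comp_apply, ← pathMap_comp, hnet.pathMap_eq_zero hQ, LinearMap.zero_apply]
  rintro ⟨a, ha⟩
  rw [typeCount_comp] at ha
  exact h ⟨a, by simp only [typeVec]; omega, by simp only [typeVec]; omega⟩

lemma IsLinkedNet.exists_smul_self (hnet : IsLinkedNet φ ty) (hγ : ∀ u v, Admissible ty (γ u v))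
    (u : Q) : ∃ c : k, ∀ s, c • pathMap φ (γ u u) s = s := by
  obtain ⟨c, hc⟩ := hnet.smul_of_admissible u u .nil (γ u u) (hγ u u)
  exact ⟨c, fun s => (LinearMap.congr_fun hc s).symm⟩

lemma IsLinkedNet.self_eq_zero (hnet : IsLinkedNet φ ty) (hγ : ∀ u v, Admissible ty (γ u v))
    {u : Q} {s : V u} (h : pathMap φ (γ u u) s = 0) : s = 0 := by
  obtain ⟨c, hc⟩ := hnet.exists_smul_self hγ u
  rw [← hc s, h, smul_zero]

lemma IsLinkedNet.self_surjective (hnet : IsLinkedNet φ ty) (hγ : ∀ u v, Admissible ty (γ u v))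
    (u : Q) : Function.Surjective (pathMap φ (γ u u)) := by
  obtain ⟨c, hc⟩ := hnet.exists_smul_self hγ u
  exact fun s => ⟨c • s, by rw [map_smul, hc]⟩

lemma IsLinkedNet.eq_zero_of_disjoint (hnet : IsLinkedNet φ ty)
    (hγ : ∀ u v, Admissible ty (γ u v)) {u v w : Q}
    (h : ∀ a, typeVec ty γ u v a = 0 ∨ typeVec ty γ u w a = 0) {s : V u}
    (hv : pathMap φ (γ u v) s = 0) (hw : pathMap φ (γ u w) s = 0) : s = 0 := by
  have hdisj : Disjoint (ess ty (γ u v)) (ess ty (γ u w)) := by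
    rw [Set.disjoint_left]
    intro a h₁ h₂
    simp only [ess, Set.mem_ofPred_eq] at h₁ h₂
    have := h a
    simp only [typeVec] at this
    omega
  have hs : s ∈ LinearMap.ker (pathMap φ (γ u v)) ⊓ LinearMap.ker (pathMap φ (γ u w)) := ⟨hv, hw⟩
  rwa [hnet.ker_inf_ker u v w _ _ (hγ u v) (hγ u w) hdisj] at hs

/-- The kernel of an admissible path grows with its essential type; so it depends only on it. -/
lemma IsLinkedNet.apply_eq_zero_of_subset (hnet : IsLinkedNet φ ty) (hQ : IsZnQuiver ty)
    (hγ : ∀ u v, Admissible ty (γ u v)) {u v w : Q}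
    (h : ∀ a, 0 < typeVec ty γ u w a → 0 < typeVec ty γ u v a) {s : V u}
    (hs : pathMap φ (γ u w) s = 0) : pathMap φ (γ u v) s = 0 := by
  obtain ⟨b, hb⟩ : ∃ b, typeVec ty γ u v b = 0 := hγ u v
  by_cases h0 : ∀ a, typeVec ty γ u v a = 0
  · obtain rfl : v = w := eq_of_typeVec_eq (γ := γ) (u := u) hQ fun a => by
      have := h a; have := h0 a; omega
    exact hs
  push Not at h0
  obtain ⟨a₀, ha₀⟩ := h0
  -- Two paths leaving `v` with disjoint essential types kill the image of `s`: one closes up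
  -- the path from `u` to a circuit, the other one extends it to a path through `w`.
  obtain ⟨x, hx⟩ := exists_typeVec_eq hQ hγ v
    (t := fun a => if typeVec ty γ u v a = 0 then 1 else 0) ⟨a₀, by simp [ha₀]⟩
  obtain ⟨y, hy⟩ := exists_typeVec_eq hQ hγ u
    (t := fun a => typeVec ty γ u v a + typeVec ty γ u w a) ⟨b, by have := h b; omega⟩
  have hvy : ∀ a, typeVec ty γ v y a = typeVec ty γ u w a :=
    typeVec_eq_of_sub hQ hγ (u := u) ⟨b, by have := h b; omega⟩ 0 fun a => by rw [hy]; omega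
  have hwy : ∀ a, typeVec ty γ w y a = typeVec ty γ u v a :=
    typeVec_eq_of_sub hQ hγ (u := u) ⟨b, hb⟩ 0 fun a => by rw [hy]; omega
  refine hnet.eq_zero_of_disjoint hγ (v := x) (w := y) (fun a => ?_) ?_ ?_
  · rw [hx, hvy]
    have := h a
    split_ifs <;> omega
  · refine hnet.comp_eq_zero hQ ?_ s
    rintro ⟨a, h₁, h₂⟩
    rw [hx, if_pos h₁] at h₂
    omega
  · rw [hnet.comp_eq_zero_iff hγ ⟨b, hb, by rw [hvy]; have := h b; omega⟩]
    rw [← hnet.comp_eq_zero_iff hγ (v := w) ⟨b, by have := h b; omega, by rw [hwy, hb]⟩, hs,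
      map_zero]

/-- Kernels turn intersections of two essential types into intersections. -/
lemma IsLinkedNet.apply_eq_zero_of_inter (hnet : IsLinkedNet φ ty) (hQ : IsZnQuiver ty)
    (hγ : ∀ u v, Admissible ty (γ u v)) {u v₁ v₂ w : Q}
    (h : ∀ a, 0 < typeVec ty γ u w a ↔ 0 < typeVec ty γ u v₁ a ∧ 0 < typeVec ty γ u v₂ a) {s : V u}
    (hs₁ : pathMap φ (γ u v₁) s = 0) (hs₂ : pathMap φ (γ u v₂) s = 0) :
    pathMap φ (γ u w) s = 0 := by
  -- Extending the path to `w` by the types of `v₁` (or `v₂`) that are missing kills `s`.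
  have key : ∀ v, (∀ a, 0 < typeVec ty γ u w a → 0 < typeVec ty γ u v a) →
      pathMap φ (γ u v) s = 0 → ∃ x, (∀ a, typeVec ty γ w x a =
        if typeVec ty γ u w a = 0 ∧ 0 < typeVec ty γ u v a then 1 else 0) ∧
        pathMap φ (γ w x) (pathMap φ (γ u w) s) = 0 := by
    intro v hv hs
    obtain ⟨b, hb⟩ : ∃ b, typeVec ty γ u v b = 0 := hγ u v
    obtain ⟨x, hx⟩ := exists_typeVec_eq hQ hγ w
      (t := fun a => if typeVec ty γ u w a = 0 ∧ 0 < typeVec ty γ u v a then 1 else 0)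
      ⟨b, by simp [hb]⟩
    have hbet : Between ty γ u w x := ⟨b, by have := hv b; omega, by rw [hx, if_neg]; omega⟩
    refine ⟨x, hx, (hnet.comp_eq_zero_iff hγ hbet s).2 ?_⟩
    refine hnet.apply_eq_zero_of_subset hQ hγ (w := v) (fun a ha => ?_) hs
    rw [← hbet.typeVec_add hQ hγ, hx]
    split_ifs <;> omega
  obtain ⟨x₁, hx₁, h₁⟩ := key v₁ (fun a ha => ((h a).1 ha).1) hs₁
  obtain ⟨x₂, hx₂, h₂⟩ := key v₂ (fun a ha => ((h a).1 ha).2) hs₂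
  refine hnet.eq_zero_of_disjoint hγ (fun a => ?_) h₁ h₂
  rw [hx₁, hx₂]
  have := h a
  split_ifs <;> omega

/-- Kernels turn finite intersections of essential types into intersections. -/
lemma IsLinkedNet.apply_eq_zero_of_iInter (hnet : IsLinkedNet φ ty) (hQ : IsZnQuiver ty)
    (hγ : ∀ u v, Admissible ty (γ u v)) {u w : Q} {A : Set Q} (hA : A.Finite) (hne : A.Nonempty)
    (h : ∀ a, 0 < typeVec ty γ u w a ↔ ∀ v ∈ A, 0 < typeVec ty γ u v a) {s : V u}
    (hs : ∀ v ∈ A, pathMap φ (γ u v) s = 0) : pathMap φ (γ u w) s = 0 := by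
  induction A, hA using Set.Finite.induction_on generalizing w with
  | empty => exact absurd hne (by simp)
  | @insert v A _ _ ih =>
    rcases A.eq_empty_or_nonempty with rfl | hA
    · exact hnet.apply_eq_zero_of_subset hQ hγ (w := v) (fun a ha => by simpa [h] using ha)
        (hs v (by simp))
    classical
    obtain ⟨x, hxA⟩ := hA
    obtain ⟨b, hb⟩ : ∃ b, typeVec ty γ u x b = 0 := hγ u x
    obtain ⟨y, hy⟩ := exists_typeVec_eq hQ hγ u
      (t := fun a => if ∀ v ∈ A, 0 < typeVec ty γ u v a then 1 else 0)
      ⟨b, if_neg fun hc => absurd (hc x hxA) (by omega)⟩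
    have hy' : ∀ a, 0 < typeVec ty γ u y a ↔ ∀ v ∈ A, 0 < typeVec ty γ u v a := fun a => by
      rw [hy]; split_ifs with hc <;> simpa using hc
    refine hnet.apply_eq_zero_of_inter hQ hγ (v₁ := v) (v₂ := y) (fun a => ?_) (hs v (by simp))
      (ih ⟨x, hxA⟩ hy' fun z hz => hs z (by simp [hz]))
    rw [h, hy', Set.forall_mem_insert]

/-! ### The minimum set of generators -/

lemma IsLinkedNet.surjective_of_path (hnet : IsLinkedNet φ ty) (hγ : ∀ u v, Admissible ty (γ u v))
    {u v : Q} (p : Quiver.Path u v) (hp : Function.Surjective (pathMap φ p)) :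
    Function.Surjective (pathMap φ (γ u v)) := by
  obtain ⟨c, hc⟩ := hnet.smul_of_admissible u v p _ (hγ u v)
  intro x
  obtain ⟨s, rfl⟩ := hp x
  exact ⟨c • s, by rw [hc]; simp⟩

lemma IsLinkedNet.surjective_trans (hnet : IsLinkedNet φ ty) (hγ : ∀ u v, Admissible ty (γ u v))
    {u v w : Q} (h₁ : Function.Surjective (pathMap φ (γ u v)))
    (h₂ : Function.Surjective (pathMap φ (γ v w))) : Function.Surjective (pathMap φ (γ u w)) :=
  hnet.surjective_of_path hγ ((γ u v).comp (γ v w)) (by rw [pathMap_comp]; exact h₂.comp h₁)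

/-- A finitely generated linked net is generated, by one vertex at a time, by a finite set:
the tropical hull of the given generators. -/
lemma IsLinkedNet.exists_finite_surjective (hnet : IsLinkedNet φ ty) (hQ : IsZnQuiver ty)
    (hγ : ∀ u v, Admissible ty (γ u v)) (hfg : FinitelyGenerated φ)
    (hnontrivial : ∃ u, Nontrivial (V u)) :
    ∃ P : Set Q, P.Finite ∧ ∀ v, ∃ w ∈ P, Function.Surjective (pathMap φ (γ w v)) := by
  obtain ⟨S, hSfin, hS⟩ := hfg
  have hne : hSfin.toFinset.Nonempty := by
    rw [Set.Finite.toFinset_nonempty]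
    by_contra hemp
    rw [Set.not_nonempty_iff_eq_empty] at hemp
    obtain ⟨u, hu⟩ := hnontrivial
    obtain ⟨x, hx⟩ := exists_ne (0 : V u)
    obtain ⟨l, -, w, hw, p, hp⟩ := hS u
    obtain ⟨s, hs⟩ := hp x
    refine hx (hs.symm.trans (Finset.sum_eq_zero fun i _ => ?_))
    have := hw i
    simp [hemp] at this
  obtain ⟨P, hP, hP'⟩ := exists_finite_between hQ hγ hne
  refine ⟨P, hP, fun v => ?_⟩
  obtain ⟨w, hw, hbet⟩ := hP' v
  refine ⟨w, hw, fun x => ?_⟩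
  obtain ⟨l, -, z, hz, p, hp⟩ := hS v
  obtain ⟨s, rfl⟩ := hp x
  change _ ∈ LinearMap.range (pathMap φ (γ w v))
  refine Submodule.sum_mem _ fun i _ => ?_
  obtain ⟨c, hc⟩ := hnet.smul_of_admissible _ _ (p i) _ (hγ (z i) v)
  rw [hc]
  exact Submodule.smul_mem _ c
    (hnet.range_le (hbet (z i) (hSfin.mem_toFinset.2 (hz i))) (LinearMap.mem_range_self _ _))

lemma generatedBy_one_of_surjective {S : Set Q}
    (h : ∀ v, Nontrivial (V v) → ∃ w ∈ S, Function.Surjective (pathMap φ (γ w v))) :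
    GeneratedBy φ 1 S := by
  intro v
  rcases subsingleton_or_nontrivial (V v) with hv | hv
  · exact ⟨0, by simp, Fin.elim0, fun i => i.elim0, fun i => i.elim0, fun x =>
      ⟨fun i => i.elim0, Subsingleton.elim _ _⟩⟩
  · obtain ⟨w, hw, hsurj⟩ := h v hv
    refine ⟨1, by simp, fun _ => w, fun _ => hw, fun _ => γ w v, fun x => ?_⟩
    obtain ⟨s, hs⟩ := hsurj x
    exact ⟨fun _ => s, by simpa using hs⟩

lemma IsLinkedNet.minGenerators_finite (hnet : IsLinkedNet φ ty) (hQ : IsZnQuiver ty)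
    (hγ : ∀ u v, Admissible ty (γ u v)) (hfg : FinitelyGenerated φ)
    (hnontrivial : ∃ u, Nontrivial (V u)) : (minGenerators φ).Finite := by
  obtain ⟨P, hP, hP'⟩ := hnet.exists_finite_surjective hQ hγ hfg hnontrivial
  exact hP.subset (Set.sInter_subset_of_mem
    (generatedBy_one_of_surjective (γ := γ) fun v _ => hP' v))

/-- If `u` generates `v ≠ u`, then nothing from `v` reaches `u`. -/
lemma IsLinkedNet.eq_zero_of_surjective (hnet : IsLinkedNet φ ty) (hQ : IsZnQuiver ty)
    (hγ : ∀ u v, Admissible ty (γ u v)) {u v : Q} (huv : u ≠ v)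
    (h : Function.Surjective (pathMap φ (γ u v))) : pathMap φ (γ v u) = 0 := by
  ext x
  obtain ⟨s, rfl⟩ := h x
  exact hnet.comp_eq_zero hQ (fun hb => huv ((between_self_iff hQ hγ).1 hb)) s

/-- The minimum set of generators `1`-generates: it contains, for each vertex with nonzero space,
a maximal one among those that generate it in a fixed finite `1`-generating set. -/
lemma IsLinkedNet.exists_mem_minGenerators (hnet : IsLinkedNet φ ty) (hQ : IsZnQuiver ty)
    (hγ : ∀ u v, Admissible ty (γ u v)) (hfg : FinitelyGenerated φ)
    {v : Q} (hv : Nontrivial (V v)) :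
    ∃ u ∈ minGenerators φ, Function.Surjective (pathMap φ (γ u v)) := by
  obtain ⟨P, hP, hP'⟩ := hnet.exists_finite_surjective hQ hγ hfg ⟨v, hv⟩
  let G : Set Q := {u ∈ P | Function.Surjective (pathMap φ (γ u v))}
  have hGfin : G.Finite := hP.subset fun u hu => hu.1
  have hGnon : ∀ u ∈ G, Nontrivial (V u) := fun u hu => hu.2.nontrivial
  let R : G → G → Prop := fun x y => (x : Q) ≠ y ∧ Function.Surjective (pathMap φ (γ x y))
  have hne : ∀ {x y : Q}, Nontrivial (V y) → x ≠ y → Function.Surjective (pathMap φ (γ x y)) →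
      ¬ Function.Surjective (pathMap φ (γ y x)) := by
    intro x y hy hxy h h'
    obtain ⟨z, hz⟩ := exists_ne (0 : V y)
    refine hz (hnet.self_eq_zero hγ (Subsingleton.elim (h := ?_) _ _))
    refine ⟨fun p q => ?_⟩
    obtain ⟨s, rfl⟩ := (h.comp h') p
    obtain ⟨t, rfl⟩ := (h.comp h') q
    simp [hnet.eq_zero_of_surjective hQ hγ hxy h]
  have : IsStrictOrder G R :=
    { irrefl := fun x h => h.1 rfl
      trans := fun x y z h₁ h₂ => by
        refine ⟨fun h => ?_, hnet.surjective_trans hγ h₁.2 h₂.2⟩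
        exact hne (hGnon y y.2) h₁.1 h₁.2 (h ▸ h₂.2) }
  have : Finite G := hGfin
  obtain ⟨w, hwP, hw⟩ := hP' v
  obtain ⟨u, -, hu⟩ := (Finite.wellFounded_of_trans_of_irrefl R).has_min Set.univ
    ⟨⟨w, hwP, hw⟩, trivial⟩
  refine ⟨u, ?_, u.2.2⟩
  have hu_non := hGnon u u.2
  -- A `1`-generating set contains a generator of `u`, which is `u` itself by maximality.
  rintro S hS
  obtain ⟨l, hl, z, hz, p, hp⟩ := hS u
  have hl : l ≤ 1 := by exact_mod_cast hl
  interval_cases l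
  · obtain ⟨x, hx⟩ := exists_ne (0 : V u)
    obtain ⟨s, hs⟩ := hp x
    exact absurd (by simpa using hs.symm) hx
  · by_contra huS
    have hzu : z 0 ≠ u := fun h => huS (h ▸ hz 0)
    have hsurj : Function.Surjective (pathMap φ (γ (z 0) u)) :=
      hnet.surjective_of_path hγ (p 0) fun x => by
        obtain ⟨s, hs⟩ := hp x
        exact ⟨s 0, by simpa using hs⟩
    obtain ⟨y, hyP, hy⟩ := hP' (z 0)
    have hyu := hnet.surjective_trans hγ hy hsurj
    refine hu ⟨y, hyP, hnet.surjective_trans hγ hyu u.2.2⟩ trivial ⟨?_, hyu⟩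
    change y ≠ u
    rintro rfl
    exact hne hu_non hzu hsurj hy

end Nets

/-! ### Interior points of the simplex and splittings -/

lemma IsOrderedPartition.index_eq {α : Type*} {m : ℕ} {π : Fin m → Set α}
    (hπ : IsOrderedPartition π) {x : α} {i j : Fin m} (hi : x ∈ π i) (hj : x ∈ π j) : i = j := by
  by_contra h
  exact Set.disjoint_left.1 (hπ.disjoint i j h) hi hj

lemma pos_of_mem_relInterior_simplex {H : Type*} {d : ℝ} (hd : 0 < d) {q : H → ℝ}
    (hq : q ∈ relInterior (simplex H d)) (u : H) : 0 < q u := by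
  classical
  obtain ⟨hqP, hq⟩ := hq
  refine (hqP.1 u).lt_of_ne fun h0 => ?_
  refine hq {x ∈ simplex H d | x u = 0} (fun _ => ?_) (fun hF => ?_) ⟨hqP, h0.symm⟩
  · refine ⟨-ContinuousLinearMap.proj (R := ℝ) (φ := fun _ : H => ℝ) u, ?_⟩
    ext x
    refine and_congr_right fun hx => ⟨fun hxu y hy => ?_, fun h => ?_⟩
    · simpa [hxu] using hy.1 u
    · have := h q hqP
      simp only [neg_apply, ContinuousLinearMap.proj_apply] at this
      have := hx.1 u
      linarith
  · have hmem : Pi.single u d ∈ simplex H d := by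
      refine ⟨fun x => ?_, ?_⟩
      · rcases eq_or_ne x u with rfl | hx
        · simpa using hd.le
        · simp [hx]
      · rw [setSum, finsum_mem_univ, finsum_eq_single _ u fun x hx => by simp [hx]]
        simp
    rw [← hF] at hmem
    exact hd.ne' (by simpa using hmem.2)

/-- Removing `u ∈ π i` changes only the `i`-th summand of a splitting along `π`. -/
lemma adjointFun_splitting_singleton {H : Type*} {m : ℕ} (μ : Set H → ℝ) {π : Fin m → Set H}
    (hπ : IsOrderedPartition π) {u : H} {i : Fin m} (hu : u ∈ π i) :
    adjointFun (splitting μ π) {u} = μ (⋃ j ≤ i, π j) - μ ((⋃ j ≤ i, π j) \ {u}) := by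
  rw [adjointFun, splitting, splitting, ← Finset.sum_sub_distrib, Finset.sum_eq_single i]
  · have h₁ : Set.univ ∩ (⋃ j ≤ i, π j) ∪ (⋃ j < i, π j) = ⋃ j ≤ i, π j := by
      rw [Set.univ_inter, Set.union_eq_left]
      exact Set.biUnion_mono (fun j (hj : j < i) => hj.le) fun _ _ => le_rfl
    have h₂ : ({u}ᶜ ∩ ⋃ j ≤ i, π j) ∪ (⋃ j < i, π j) = (⋃ j ≤ i, π j) \ {u} := by
      rw [Set.inter_comm, ← Set.sdiff_eq, Set.union_eq_left]
      intro x hx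
      simp only [Set.mem_iUnion, exists_prop] at hx
      obtain ⟨j, hj, hxj⟩ := hx
      refine ⟨Set.mem_biUnion (x := j) (le_of_lt hj) hxj, ?_⟩
      rintro rfl
      exact hj.ne (hπ.index_eq hxj hu)
    simp only [minorFun, h₁, h₂]
    ring
  · intro j _ hj
    have : Set.univ ∩ (⋃ l ≤ j, π l) ∪ (⋃ l < j, π l) =
        ({u}ᶜ ∩ ⋃ l ≤ j, π l) ∪ (⋃ l < j, π l) := by
      ext x
      simp only [Set.univ_inter, Set.mem_union, Set.mem_inter_iff, Set.mem_compl_iff,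
        Set.mem_singleton_iff, Set.mem_iUnion, exists_prop]
      by_cases hx : x = u
      · subst hx
        refine ⟨?_, fun h => h.imp_left fun h => h.2⟩
        rintro (⟨l, hl, hxl⟩ | h)
        · obtain rfl := hπ.index_eq hxl hu
          exact Or.inr ⟨l, lt_of_le_of_ne hl hj.symm, hxl⟩
        · exact Or.inr h
      · simp [hx]
    simp only [minorFun, this, sub_self]
  · simp

section Vertex

variable {n : ℕ} {Q : Type*} [Quiver Q] {ty : ∀ ⦃u v : Q⦄, (u ⟶ v) → Fin (n + 1)}
  {k : Type*} [Field k] {V : Q → Type*} [∀ v, AddCommGroup (V v)] [∀ v, Module k (V v)]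
  {φ : ∀ ⦃u v : Q⦄, (u ⟶ v) → V u →ₗ[k] V v} {γ : ∀ u v : Q, Quiver.Path u v} {H : Set Q}

/-- The vectors at `v` whose images at all vertices of `H` outside `A` vanish. -/
def vanishing (φ : ∀ ⦃u v : Q⦄, (u ⟶ v) → V u →ₗ[k] V v) (γ : ∀ u v : Q, Quiver.Path u v)
    (v : Q) (A : Set H) : Submodule k (V v) :=
  ⨅ u ∈ Aᶜ, LinearMap.ker (pathMap φ (γ v (u : H)))

lemma mem_vanishing {v : Q} {A : Set H} {s : V v} :
    s ∈ vanishing φ γ v A ↔ ∀ u : H, u ∉ A → pathMap φ (γ v u) s = 0 := by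
  simp [vanishing]

lemma subspaceFun_vertexSpace (hnet : IsLinkedNet φ ty) (hγ : ∀ u v, Admissible ty (γ u v))
    {v : Q} (hv : v ∈ H) (A : Set H) :
    subspaceFun (vertexSpace φ γ H v) A = Module.finrank k (vanishing φ γ v A) := by
  have hinj : Function.Injective (psi φ γ H v) := by
    rw [injective_iff_map_eq_zero]
    exact fun s hs => hnet.self_eq_zero hγ (congrFun hs ⟨v, hv⟩)
  have : vertexSpace φ γ H v ⊓ (⨅ u ∈ Aᶜ, LinearMap.ker (LinearMap.proj u)) =
      (vanishing φ γ v A).map (psi φ γ H v) := by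
    ext x
    simp only [vertexSpace, Submodule.mem_inf, LinearMap.mem_range, Submodule.mem_iInf,
      LinearMap.mem_ker, LinearMap.proj_apply, Submodule.mem_map, mem_vanishing]
    constructor
    · rintro ⟨⟨s, rfl⟩, hs⟩
      exact ⟨s, fun u hu => hs u hu, rfl⟩
    · rintro ⟨s, hs, rfl⟩
      exact ⟨⟨s, rfl⟩, fun u hu => hs u hu⟩
  rw [subspaceFun, this, ← (Submodule.equivMapOfInjective _ hinj _).finrank_eq]

/-- An interior point `q` of the simplex on the face `P_{v,π}` has `q u > 0`, while `q u` is at most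
the drop in dimension when vanishing at `u` is imposed on the vectors at `v` that vanish on the
blocks after `π i`. So that condition is not automatic. -/
lemma exists_apply_ne_zero [∀ v, FiniteDimensional k (V v)] (hnet : IsLinkedNet φ ty)
    (hγ : ∀ u v, Admissible ty (γ u v)) {v : Q} (hv : v ∈ H) {m : ℕ} {π : Fin m → Set H}
    (hπ : IsOrderedPartition π) {d : ℝ} (hd : 0 < d)
    (hmeet : (vertexFace φ γ H v π ∩ relInterior (simplex H d)).Nonempty)
    (i : Fin m) (u : H) (hu : u ∈ π i) :
    ∃ s : V v, (∀ j, i < j → ∀ x ∈ π j, pathMap φ (γ v x) s = 0) ∧ pathMap φ (γ v u) s ≠ 0 := by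
  obtain ⟨q, hqP, hq⟩ := hmeet
  have hpos := pos_of_mem_relInterior_simplex hd hq u
  have hle := (hqP {u}).2
  rw [adjointFun_splitting_singleton _ hπ hu, subspaceFun_vertexSpace hnet hγ hv,
    subspaceFun_vertexSpace hnet hγ hv, setSum, finsum_mem_singleton] at hle
  by_contra! hcon
  have : vanishing φ γ v (⋃ j ≤ i, π j) ≤ vanishing φ γ v ((⋃ j ≤ i, π j) \ {u}) := by
    intro s hs
    rw [mem_vanishing] at hs ⊢
    intro x hx
    by_cases hxu : x = u
    · subst hxu
      refine hcon s fun j hj y hy => hs y ?_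
      simp only [Set.mem_iUnion, exists_prop, not_exists, not_and]
      intro l hl hyl
      exact (hl.trans_lt hj).ne (hπ.index_eq hyl hy)
    · exact hs x fun h => hx ⟨h, hxu⟩
  have := Submodule.finrank_mono this
  have : (Module.finrank k (vanishing φ γ v (⋃ j ≤ i, π j)) : ℝ) ≤
    Module.finrank k (vanishing φ γ v ((⋃ j ≤ i, π j) \ {u})) := by exact_mod_cast this
  linarith

end Vertex

/-! ### The polygon of a flag of sets of arrow types -/

section Flag

variable {n : ℕ} {Q : Type*} [Quiver Q] {ty : ∀ ⦃u v : Q⦄, (u ⟶ v) → Fin (n + 1)}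
  {γ : ∀ u v : Q, Quiver.Path u v} {H : Set Q} {m : ℕ}

/-- The types common to all paths from `v` to the blocks `π j` with `k ≤ j`. This is all of the set
of types for `k = m`. -/
def typeFlag (ty : ∀ ⦃u v : Q⦄, (u ⟶ v) → Fin (n + 1)) (γ : ∀ u v : Q, Quiver.Path u v) (v : Q)
    (π : Fin m → Set H) (k : ℕ) : Set (Fin (n + 1)) :=
  {a | ∀ j : Fin m, k ≤ j → ∀ u ∈ π j, 0 < typeVec ty γ v u a}

/-- The vertices `w i` are obtained from `v` by moving once along each type of the flag `J`, and
`J i` is the last member of the flag contained in the essential type from `v` to any vertex in the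
block `π i`. Then the `w i` form an oriented polygon that induces `π`. -/
structure IsFlagPolygon (ty : ∀ ⦃u v : Q⦄, (u ⟶ v) → Fin (n + 1)) (γ : ∀ u v : Q, Quiver.Path u v)
    (v : Q) (π : Fin m → Set H) (J : ℕ → Set (Fin (n + 1))) (w : Fin m → Q) : Prop where
  mono : Monotone J
  zero : J 0 = ∅
  top : J m = Set.univ
  eq_one : ∀ i : Fin m, ∀ a ∈ J i, typeVec ty γ v (w i) a = 1
  eq_zero : ∀ i : Fin m, ∀ a ∉ J i, typeVec ty γ v (w i) a = 0
  pos : ∀ i : Fin m, ∀ u ∈ π i, ∀ a ∈ J i, 0 < typeVec ty γ v u a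
  exists_eq_zero : ∀ i : Fin m, ∀ u ∈ π i, ∀ l : ℕ, i < l → l ≤ m →
    ∃ a ∈ J l, typeVec ty γ v u a = 0

namespace IsFlagPolygon

variable {v : Q} {π : Fin m → Set H} {J : ℕ → Set (Fin (n + 1))} {w : Fin m → Q}

lemma first_eq (hF : IsFlagPolygon ty γ v π J w) (hQ : IsZnQuiver ty)
    (hγ : ∀ u v, Admissible ty (γ u v)) {i : Fin m} (hi : (i : ℕ) = 0) : w i = v :=
  eq_of_typeVec_eq (γ := γ) (u := v) hQ fun a => by
    rw [typeVec_self hQ hγ, hF.eq_zero i a (by rw [hi, hF.zero]; simp)]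

lemma typeVec_le_of_mem (hF : IsFlagPolygon ty γ v π J w) {i j : Fin m} (hij : i ≤ j) {u : H}
    (hu : u ∈ π j) (a : Fin (n + 1)) : typeVec ty γ v (w i) a ≤ typeVec ty γ v u a := by
  by_cases ha : a ∈ J i
  · rw [hF.eq_one i a ha]
    exact hF.pos j u hu a (hF.mono hij ha)
  · rw [hF.eq_zero i a ha]
    exact Nat.zero_le _

lemma typeVec_le_of_le (hF : IsFlagPolygon ty γ v π J w) {i j : Fin m} (hij : i ≤ j)
    (a : Fin (n + 1)) : typeVec ty γ v (w i) a ≤ typeVec ty γ v (w j) a := by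
  by_cases ha : a ∈ J i
  · rw [hF.eq_one i a ha, hF.eq_one j a (hF.mono hij ha)]
  · rw [hF.eq_zero i a ha]
    exact Nat.zero_le _

lemma between_of_mem (hF : IsFlagPolygon ty γ v π J w) (hQ : IsZnQuiver ty)
    (hγ : ∀ u v, Admissible ty (γ u v)) {i j : Fin m} (hij : i ≤ j) {u : H}
    (hu : u ∈ π j) : Between ty γ v (w i) u :=
  between_of_typeVec_le hQ hγ (hF.typeVec_le_of_mem hij hu)

lemma between_of_le (hF : IsFlagPolygon ty γ v π J w) (hQ : IsZnQuiver ty)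
    (hγ : ∀ u v, Admissible ty (γ u v)) {i j : Fin m} (hij : i ≤ j) :
    Between ty γ v (w i) (w j) :=
  between_of_typeVec_le hQ hγ (hF.typeVec_le_of_le hij)

lemma exists_mem_diff (hF : IsFlagPolygon ty γ v π J w) (hπ : IsOrderedPartition π) {i : Fin m}
    {l : ℕ} (h : i < l) (hl : l ≤ m) : ∃ a ∈ J l, a ∉ J i := by
  obtain ⟨u, hu⟩ := hπ.nonempty i
  obtain ⟨a, ha, h0⟩ := hF.exists_eq_zero i u hu l h hl
  exact ⟨a, ha, fun hai => by have := hF.pos i u hu a hai; omega⟩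

lemma typeVec_backward (hF : IsFlagPolygon ty γ v π J w) (hQ : IsZnQuiver ty)
    (hγ : ∀ u v, Admissible ty (γ u v)) (hπ : IsOrderedPartition π) {i j : Fin m} (hij : i < j)
    (a : Fin (n + 1)) :
    typeVec ty γ (w j) (w i) a + typeVec ty γ v (w j) a = typeVec ty γ v (w i) a + 1 := by
  obtain ⟨b, hb, hb'⟩ := hF.exists_mem_diff hπ (i := i) (l := j) hij j.2.le
  have hle : ∀ c, typeVec ty γ v (w j) c ≤ 1 := fun c => by
    by_cases hc : c ∈ J j
    · rw [hF.eq_one j c hc]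
    · rw [hF.eq_zero j c hc]; exact Nat.zero_le _
  have := typeVec_eq_of_sub hQ hγ (u := v) (v := w j) (w := w i)
    (t := fun a => typeVec ty γ v (w i) a + 1 - typeVec ty γ v (w j) a)
    ⟨b, by rw [hF.eq_one j b hb, hF.eq_zero i b hb']⟩ (-1)
    (fun a => by have := hle a; omega) a
  have := hle a
  omega

/-- Along the oriented polygon, `w i` is on the way from any `w j` to the vertices of `π i`. -/
lemma between_vertices (hF : IsFlagPolygon ty γ v π J w) (hQ : IsZnQuiver ty)
    (hγ : ∀ u v, Admissible ty (γ u v)) (hπ : IsOrderedPartition π) {i : Fin m} (j : Fin m) {u : H}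
    (hu : u ∈ π i) : Between ty γ (w j) (w i) u := by
  have hiu := (hF.between_of_mem hQ hγ le_rfl hu).typeVec_add hQ hγ
  rcases le_or_gt j i with hji | hij
  · obtain ⟨b, hb⟩ : ∃ b, typeVec ty γ v u b = 0 := hγ v u
    have := (hF.between_of_le hQ hγ hji).typeVec_add hQ hγ b
    have := hiu b
    exact ⟨b, by omega, by omega⟩
  · obtain ⟨b, hb, hb'⟩ := hF.exists_eq_zero i u hu j hij j.2.le
    have := hF.typeVec_backward hQ hγ hπ hij b
    have := hF.eq_one j b hb
    have := hiu b
    exact ⟨b, by omega, by omega⟩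

lemma injective (hF : IsFlagPolygon ty γ v π J w) (hπ : IsOrderedPartition π) :
    Function.Injective w := by
  intro i j h
  by_contra hne
  wlog hij : i < j generalizing i j
  · exact this h.symm (Ne.symm hne) (lt_of_le_of_ne (not_lt.1 hij) (Ne.symm hne))
  obtain ⟨b, hb, hb'⟩ := hF.exists_mem_diff hπ (i := i) (l := j) hij j.2.le
  have := hF.eq_one j b hb
  rw [← h, hF.eq_zero i b hb'] at this
  omega

lemma typeVec_forward (hF : IsFlagPolygon ty γ v π J w) (hQ : IsZnQuiver ty)
    (hγ : ∀ u v, Admissible ty (γ u v)) {i j : Fin m} (hij : i ≤ j) (a : Fin (n + 1)) :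
    typeVec ty γ v (w i) a + typeVec ty γ (w i) (w j) a = typeVec ty γ v (w j) a :=
  (hF.between_of_le hQ hγ hij).typeVec_add hQ hγ a

lemma typeVec_le_one (hF : IsFlagPolygon ty γ v π J w) (hQ : IsZnQuiver ty)
    (hγ : ∀ u v, Admissible ty (γ u v)) (hπ : IsOrderedPartition π) (i j : Fin m)
    (a : Fin (n + 1)) : typeVec ty γ (w i) (w j) a ≤ 1 := by
  rcases le_or_gt i j with hij | hij
  · have := hF.typeVec_forward hQ hγ hij a
    by_cases ha : a ∈ J j
    · have := hF.eq_one j a ha; omega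
    · have := hF.eq_zero j a ha; omega
  · have := hF.typeVec_backward hQ hγ hπ hij a
    have := hF.typeVec_le_of_le hij.le a
    omega

lemma neighbor (hF : IsFlagPolygon ty γ v π J w) (hQ : IsZnQuiver ty)
    (hγ : ∀ u v, Admissible ty (γ u v)) (hπ : IsOrderedPartition π) {i j : Fin m} (hij : i ≠ j) :
    Neighbor ty (w i) (w j) :=
  neighbor_of_typeVec_le_one ((hF.injective hπ).ne hij) (hF.typeVec_le_one hQ hγ hπ i j)

lemma isShadow (hF : IsFlagPolygon ty γ v π J w) (hQ : IsZnQuiver ty)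
    (hγ : ∀ u v, Admissible ty (γ u v)) (hπ : IsOrderedPartition π) {i : Fin m} {u : H}
    (hu : u ∈ π i) : IsShadow ty (Set.range w) u (w i) := by
  rw [isShadow_iff hQ hγ]
  refine ⟨Set.mem_range_self i, ?_⟩
  rintro _ ⟨j, rfl⟩
  exact hF.between_vertices hQ hγ hπ j hu

lemma mem_shadowRegion_iff (hF : IsFlagPolygon ty γ v π J w) (hQ : IsZnQuiver ty)
    (hγ : ∀ u v, Admissible ty (γ u v)) (hπ : IsOrderedPartition π) {i : Fin m} {u : H} :
    (u : Q) ∈ shadowRegion ty (Set.range w) (w i) ↔ u ∈ π i := by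
  refine ⟨fun h => ?_, fun h => hF.isShadow hQ hγ hπ h⟩
  obtain ⟨j, hj⟩ := hπ.cover u
  obtain rfl := hF.injective hπ ((hF.isShadow hQ hγ hπ hj).unique hQ hγ h)
  exact hj

lemma isOrientedGon (hF : IsFlagPolygon ty γ v π J w) (hQ : IsZnQuiver ty)
    (hγ : ∀ u v, Admissible ty (γ u v)) (hπ : IsOrderedPartition π) : IsOrientedGon ty w := by
  refine ⟨fun i => J (i + 1) \ J i, ⟨fun i => ?_, fun i j hij => ?_, fun a => ?_⟩,
    fun i j hij => ?_⟩
  · exact hF.exists_mem_diff hπ (Nat.lt_succ_self i) i.2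
  · wlog h : i < j generalizing i j
    · exact (this j i hij.symm (lt_of_le_of_ne (not_lt.1 h) hij.symm)).symm
    rw [Set.disjoint_left]
    exact fun a hi hj => hj.2 (hF.mono (Nat.succ_le_of_lt h) hi.1)
  · -- The first member of the flag that contains `a` is not `J 0 = ∅`.
    classical
    have hex : ∃ l, a ∈ J l := ⟨m, by rw [hF.top]; trivial⟩
    have h0 : Nat.find hex ≠ 0 := fun h => by
      have := Nat.find_spec hex
      rw [h, hF.zero] at this
      exact this
    have hm : Nat.find hex ≤ m := Nat.find_min' hex (by rw [hF.top]; trivial)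
    refine ⟨⟨Nat.find hex - 1, by omega⟩, ?_, Nat.find_min hex (Nat.sub_one_lt h0)⟩
    have := Nat.find_spec hex
    rwa [← Nat.sub_one_add_one h0] at this
  · have hlt : i < j := by rw [Fin.lt_def]; omega
    refine ⟨(hF.injective hπ).ne hlt.ne, γ _ _, hF.typeVec_le_one hQ hγ hπ i j, ?_⟩
    ext a
    have h := hF.typeVec_forward hQ hγ hlt.le a
    change 0 < typeVec ty γ (w i) (w j) a ↔ a ∈ J (i + 1) ∧ a ∉ J i
    rw [hij]
    by_cases hi : a ∈ J i
    · have := hF.eq_one i a hi; have := hF.eq_one j a (hF.mono hlt.le hi)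
      simp only [hi, not_true, and_false, iff_false]
      omega
    · have := hF.eq_zero i a hi
      by_cases hj : a ∈ J j
      · have := hF.eq_one j a hj
        simp only [hi, hj, not_false_iff, and_true, iff_true]
        omega
      · have := hF.eq_zero j a hj
        simp only [hj, false_and, iff_false]
        omega

end IsFlagPolygon

lemma exists_isFlagPolygon (hQ : IsZnQuiver ty) (hγ : ∀ u v, Admissible ty (γ u v)) {v : Q}
    {π : Fin m → Set H} (hπ : IsOrderedPartition π)
    (hzero : typeFlag ty γ v π 0 = ∅)
    (hsep : ∀ i : Fin m, ∀ u ∈ π i, ∀ j : Fin m, i < j →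
      ∃ a ∈ typeFlag ty γ v π j, typeVec ty γ v u a = 0) :
    ∃ w, IsFlagPolygon ty γ v π (typeFlag ty γ v π) w := by
  classical
  have hpos : ∀ i : Fin m, ∀ u ∈ π i, ∀ a ∈ typeFlag ty γ v π i, 0 < typeVec ty γ v u a :=
    fun i u hu a ha => ha i le_rfl u hu
  have htop : typeFlag ty γ v π m = Set.univ :=
    Set.eq_univ_of_forall fun a j hj => absurd j.2 (not_lt.2 hj)
  have hex : ∀ i : Fin m, ∃ x, ∀ a,
      typeVec ty γ v x a = if a ∈ typeFlag ty γ v π i then 1 else 0 := fun i => by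
    obtain ⟨u, hu⟩ := hπ.nonempty i
    obtain ⟨b, hb⟩ : ∃ b, typeVec ty γ v u b = 0 := hγ v u
    exact exists_typeVec_eq hQ hγ v ⟨b, if_neg fun h => by have := hpos i u hu b h; omega⟩
  choose w hw using hex
  refine ⟨w, fun k l hkl a ha j hj => ha j (hkl.trans hj), hzero, htop,
    fun i a ha => by rw [hw, if_pos ha], fun i a ha => by rw [hw, if_neg ha], hpos,
    fun i u hu l hil hl => ?_⟩
  rcases hl.lt_or_eq with hl | rfl
  · exact hsep i u hu ⟨l, hl⟩ hil
  · obtain ⟨b, hb⟩ : ∃ b, typeVec ty γ v u b = 0 := hγ v u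
    exact ⟨b, by rw [htop]; trivial, hb⟩

end Flag

/-! ### The polygon of a face that meets the interior of the simplex -/

section Face

variable {n : ℕ} {Q : Type*} [Quiver Q] {ty : ∀ ⦃u v : Q⦄, (u ⟶ v) → Fin (n + 1)}
  {k : Type*} [Field k] {V : Q → Type*} [∀ v, AddCommGroup (V v)] [∀ v, Module k (V v)]
  {φ : ∀ ⦃u v : Q⦄, (u ⟶ v) → V u →ₗ[k] V v} {γ : ∀ u v : Q, Quiver.Path u v} {H : Set Q}
  {m : ℕ} {π : Fin m → Set H} {v : Q}

/-- Each block reaches further than the following ones: some vector at `v` vanishes on all later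
blocks, but not at the given vertex of `π i`. -/
def Separates (φ : ∀ ⦃u v : Q⦄, (u ⟶ v) → V u →ₗ[k] V v) (γ : ∀ u v : Q, Quiver.Path u v)
    (v : Q) (π : Fin m → Set H) : Prop :=
  ∀ i, ∀ u ∈ π i, ∃ s : V v,
    (∀ j, i < j → ∀ x ∈ π j, pathMap φ (γ v x) s = 0) ∧ pathMap φ (γ v u) s ≠ 0

/-- The vectors at `v` that vanish on all blocks from `π i` on are killed by the single path along
the types in the `i`-th member of the flag. -/
lemma IsLinkedNet.apply_eq_zero_of_typeFlag (hnet : IsLinkedNet φ ty) (hQ : IsZnQuiver ty)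
    (hγ : ∀ u v, Admissible ty (γ u v)) (hfin : H.Finite) (hπ : IsOrderedPartition π) {i : Fin m}
    {x : Q} (hx : ∀ a, 0 < typeVec ty γ v x a ↔ a ∈ typeFlag ty γ v π i) {s : V v}
    (hs : ∀ j, i ≤ j → ∀ u ∈ π j, pathMap φ (γ v u) s = 0) : pathMap φ (γ v x) s = 0 := by
  obtain ⟨u₀, hu₀⟩ := hπ.nonempty i
  refine hnet.apply_eq_zero_of_iInter hQ hγ (A := {y | ∃ j, i ≤ j ∧ ∃ u ∈ π j, (u : Q) = y})
    (hfin.subset ?_) ⟨u₀, i, le_rfl, u₀, hu₀, rfl⟩ (fun a => ?_) ?_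
  · rintro _ ⟨j, -, u, -, rfl⟩
    exact u.2
  · rw [hx]
    constructor
    · rintro ha _ ⟨j, hj, u, hu, rfl⟩
      exact ha j hj u hu
    · exact fun h j hj u hu => h u ⟨j, hj, u, hu, rfl⟩
  · rintro _ ⟨j, hj, u, hu, rfl⟩
    exact hs j hj u hu

lemma Separates.mem_first (hsep : Separates φ γ v π) (hnet : IsLinkedNet φ ty)
    (hγ : ∀ u v, Admissible ty (γ u v)) (hπ : IsOrderedPartition π) (hv : v ∈ H)
    {i : Fin m} (hi : (i : ℕ) = 0) : ⟨v, hv⟩ ∈ π i := by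
  obtain ⟨j, hj⟩ := hπ.cover ⟨v, hv⟩
  rcases eq_or_ne i j with rfl | hij
  · exact hj
  obtain ⟨u, hu⟩ := hπ.nonempty i
  obtain ⟨s, hs, hs'⟩ := hsep i u hu
  have hlt : i < j := lt_of_le_of_ne (by rw [Fin.le_def]; omega) hij
  exact absurd (by rw [hnet.self_eq_zero hγ (hs j hlt _ hj), map_zero]) hs'

lemma Separates.exists_isFlagPolygon (hsep : Separates φ γ v π) (hnet : IsLinkedNet φ ty)
    (hQ : IsZnQuiver ty) (hγ : ∀ u v, Admissible ty (γ u v)) (hfin : H.Finite)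
    (hπ : IsOrderedPartition π) (hv : v ∈ H) :
    ∃ w, IsFlagPolygon ty γ v π (typeFlag ty γ v π) w := by
  classical
  refine LinkedNet.exists_isFlagPolygon hQ hγ hπ ?_ fun i u hu j hij => ?_
  · refine Set.eq_empty_of_forall_notMem fun a ha => ?_
    obtain ⟨j, hj⟩ := hπ.cover ⟨v, hv⟩
    have := ha j (Nat.zero_le _) _ hj
    rw [typeVec_self hQ hγ] at this
    exact this.ne rfl
  · by_contra! hcon
    obtain ⟨y, hy⟩ := hπ.nonempty j
    obtain ⟨b, hb⟩ : ∃ b, typeVec ty γ v y b = 0 := hγ v y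
    obtain ⟨x, hx⟩ := exists_typeVec_eq hQ hγ v
      (t := fun a => if a ∈ typeFlag ty γ v π j then 1 else 0)
      ⟨b, if_neg fun h => by have := h j le_rfl y hy; omega⟩
    have hx' : ∀ a, 0 < typeVec ty γ v x a ↔ a ∈ typeFlag ty γ v π j := fun a => by
      rw [hx]; split_ifs with h <;> simp [h]
    obtain ⟨s, hs, hs'⟩ := hsep i u hu
    refine hs' (hnet.apply_eq_zero_of_subset hQ hγ (w := x) (fun a ha => ?_)
      (hnet.apply_eq_zero_of_typeFlag hQ hγ hfin hπ hx' fun l hl => hs l (hij.trans_le hl)))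
    exact Nat.pos_of_ne_zero (hcon a ((hx' a).1 ha))

variable {w : Fin m → Q}

lemma IsFlagPolygon.apply_eq_zero_iff (hF : IsFlagPolygon ty γ v π (typeFlag ty γ v π) w)
    (hnet : IsLinkedNet φ ty) (hQ : IsZnQuiver ty) (hγ : ∀ u v, Admissible ty (γ u v))
    (hfin : H.Finite) (hπ : IsOrderedPartition π) (i : Fin m) (s : V v) :
    pathMap φ (γ v (w i)) s = 0 ↔ ∀ j, i ≤ j → ∀ u ∈ π j, pathMap φ (γ v u) s = 0 := by
  refine ⟨fun h j hj u hu => ?_, fun h => ?_⟩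
  · rw [← hnet.comp_eq_zero_iff hγ (hF.between_of_mem hQ hγ hj hu), h, map_zero]
  · refine hnet.apply_eq_zero_of_typeFlag hQ hγ hfin hπ (fun a => ?_) h
    by_cases ha : a ∈ typeFlag ty γ v π i
    · simp [ha, hF.eq_one i a ha]
    · simp [ha, hF.eq_zero i a ha]

/-- No vertex of the polygon is generated by another vertex of `H`, as its maps to all vertices of
`H` are nonzero. Behind the given vertex on the polygon, this uses exactness to lift a separating
vector. -/
lemma IsFlagPolygon.exists_apply_ne_zero (hF : IsFlagPolygon ty γ v π (typeFlag ty γ v π) w)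
    (hnet : IsLinkedNet φ ty) (hexact : IsExact φ ty) (hQ : IsZnQuiver ty)
    (hγ : ∀ u v, Admissible ty (γ u v)) (hfin : H.Finite) (hπ : IsOrderedPartition π)
    (hsep : Separates φ γ v π) (i : Fin m) (u : H) :
    ∃ z, pathMap φ (γ (w i) u) z ≠ 0 := by
  obtain ⟨j, hj⟩ := hπ.cover u
  obtain ⟨s, hs, hs'⟩ := hsep j u hj
  rcases le_or_gt i j with hij | hji
  · exact ⟨_, fun h => hs' ((hnet.comp_eq_zero_iff hγ (hF.between_of_mem hQ hγ hij hj) s).1 h)⟩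
  · have hsi : pathMap φ (γ v (w i)) s = 0 :=
      (hF.apply_eq_zero_iff hnet hQ hγ hfin hπ i s).2 fun l hl => hs l (hji.trans_le hl)
    have hker : pathMap φ (γ v (w j)) s ∈ LinearMap.ker (pathMap φ (γ (w j) (w i))) :=
      (hnet.comp_eq_zero_iff hγ (hF.between_of_le hQ hγ hji.le) s).2 hsi
    rw [← hexact _ _ (hF.neighbor hQ hγ hπ hji.ne') _ _ (hγ (w i) (w j)) (hγ _ _)] at hker
    obtain ⟨z, hz⟩ := hker
    refine ⟨z, fun h => hs' ?_⟩
    rw [← hnet.comp_eq_zero_iff hγ (hF.between_vertices hQ hγ hπ i hj), hz,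
      hnet.comp_eq_zero_iff hγ (hF.between_of_mem hQ hγ le_rfl hj)] at h
    exact h

lemma IsFlagPolygon.mem_minGenerators
    {π : Fin m → Set (minGenerators φ)} (hF : IsFlagPolygon ty γ v π (typeFlag ty γ v π) w)
    (hnet : IsLinkedNet φ ty) (hexact : IsExact φ ty) (hQ : IsZnQuiver ty)
    (hγ : ∀ u v, Admissible ty (γ u v)) (hfg : FinitelyGenerated φ)
    (hπ : IsOrderedPartition π) (hfin : (minGenerators φ).Finite)
    (hsep : Separates φ γ v π) (i : Fin m) : w i ∈ minGenerators φ := by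
  have hne := hF.exists_apply_ne_zero hnet hexact hQ hγ hfin hπ hsep i
  obtain ⟨u₀, -⟩ := hπ.nonempty i
  obtain ⟨z, hz⟩ := hne u₀
  have hnon : Nontrivial (V (w i)) := ⟨z, 0, fun h => hz (by rw [h, map_zero])⟩
  obtain ⟨u, hu, hsurj⟩ := hnet.exists_mem_minGenerators hQ hγ hfg hnon
  by_contra hi
  obtain ⟨z, hz⟩ := hne ⟨u, hu⟩
  have hne : u ≠ w i := fun h => hi (h ▸ hu)
  exact hz (LinearMap.congr_fun (hnet.eq_zero_of_surjective hQ hγ hne hsurj) z)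

/-! ### The polytope of the polygon -/

lemma finrank_eq_finrank_map_add {k V W : Type*} [Field k] [AddCommGroup V] [Module k V]
    [FiniteDimensional k V] [AddCommGroup W] [Module k W] (f : V →ₗ[k] W) {A : Submodule k V}
    (hA : LinearMap.ker f ≤ A) :
    Module.finrank k A = Module.finrank k (A.map f) + Module.finrank k (LinearMap.ker f) := by
  rw [← (f.domRestrict A).finrank_range_add_finrank_ker, LinearMap.range_domRestrict,
    LinearMap.ker_domRestrict, (Submodule.comapSubtypeEquivOfLe hA).finrank_eq]

/-- The set cut out by the `i`-th summand of a splitting. -/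
def splitSet {H : Type*} (π : Fin m → Set H) (I : Set H) (i : Fin m) : Set H :=
  (I ∩ ⋃ j ≤ i, π j) ∪ ⋃ j < i, π j

lemma notMem_splitSet_iff {H : Type*} {π : Fin m → Set H} (hπ : IsOrderedPartition π) {I : Set H}
    {i j : Fin m} {u : H} (hu : u ∈ π j) : u ∉ splitSet π I i ↔ i < j ∨ i = j ∧ u ∉ I := by
  have h₁ : u ∈ ⋃ l ≤ i, π l ↔ j ≤ i := by
    simp only [Set.mem_iUnion, exists_prop]
    exact ⟨fun ⟨l, hl, hul⟩ => hπ.index_eq hul hu ▸ hl, fun h => ⟨j, h, hu⟩⟩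
  have h₂ : u ∈ ⋃ l < i, π l ↔ j < i := by
    simp only [Set.mem_iUnion, exists_prop]
    exact ⟨fun ⟨l, hl, hul⟩ => hπ.index_eq hul hu ▸ hl, fun h => ⟨j, h, hu⟩⟩
  rw [splitSet, Set.mem_union, Set.mem_inter_iff, h₁, h₂]
  rcases lt_trichotomy i j with h | rfl | h
  · simp [h, h.not_ge, h.not_gt]
  · simp
  · simp [h, h.not_gt, h.ne']

/-- The vectors at `w i` that contribute to the part of the space of the polygon supported
on `I`. -/
def blockSpace (φ : ∀ ⦃u v : Q⦄, (u ⟶ v) → V u →ₗ[k] V v) (γ : ∀ u v : Q, Quiver.Path u v)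
    (v : Q) (π : Fin m → Set H) (w : Fin m → Q) (I : Set H) (i : Fin m) : Submodule k (V (w i)) :=
  (vanishing φ γ v (splitSet π I i)).map (pathMap φ (γ v (w i)))

/-- The image in `V (w i)` of a step of the filtration of `V v` is cut out by the conditions for
membership in `V_Δ`, together with vanishing on `π i` outside `I`. Vectors satisfying them lift to
`V v` by exactness, since they vanish at `v ∈ π 0`. -/
lemma IsFlagPolygon.mem_blockSpace_iff (hF : IsFlagPolygon ty γ v π (typeFlag ty γ v π) w)
    (hnet : IsLinkedNet φ ty) (hexact : IsExact φ ty) (hQ : IsZnQuiver ty)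
    (hγ : ∀ u v, Admissible ty (γ u v)) (hπ : IsOrderedPartition π) (hv : v ∈ H)
    (hfirst : ∀ i : Fin m, (i : ℕ) = 0 → ⟨v, hv⟩ ∈ π i) (I : Set H) (i : Fin m) (c : V (w i)) :
    c ∈ blockSpace φ γ v π w I i ↔
      ∀ j, ∀ u ∈ π j, (j = i → u ∉ I) → pathMap φ (γ (w i) u) c = 0 := by
  constructor
  · rintro ⟨s, hs, rfl⟩ j u hu hj
    rw [SetLike.mem_coe, mem_vanishing] at hs
    rcases le_or_gt i j with hij | hji
    · rw [hnet.comp_eq_zero_iff hγ (hF.between_of_mem hQ hγ hij hu)]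
      refine hs u ((notMem_splitSet_iff hπ hu).2 ?_)
      exact hij.lt_or_eq.imp_right fun h => ⟨h, hj h.symm⟩
    · -- The path from `v` to `w i` and on to `w j` is not admissible for `j < i`.
      rw [← hnet.comp_eq_zero_iff hγ (hF.between_vertices hQ hγ hπ i hu),
        hnet.comp_eq_zero hQ (u := v) (v := w i) (w := w j), map_zero]
      rintro ⟨a, h₁, h₂⟩
      have := hF.typeVec_backward hQ hγ hπ hji a
      omega
  · intro hc
    have hrange : c ∈ LinearMap.range (pathMap φ (γ v (w i))) := by
      rcases Nat.eq_zero_or_pos (i : ℕ) with hi | hi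
      · have hw := hF.first_eq hQ hγ hi
        have : Function.Surjective (pathMap φ (γ v (w i))) := by
          rw [hw]
          exact hnet.self_surjective hγ v
        exact this c
      · have h0 : (⟨0, hi.trans i.2⟩ : Fin m) ≠ i := fun h => by
          have := congrArg Fin.val h
          simp only at this
          omega
        have hw := hF.first_eq hQ hγ (i := ⟨0, hi.trans i.2⟩) rfl
        have hnb := hF.neighbor hQ hγ hπ h0
        rw [hw] at hnb
        rw [hexact _ _ hnb _ _ (hγ _ _) (hγ (w i) v)]
        exact hc _ _ (hfirst ⟨0, hi.trans i.2⟩ rfl) fun h => absurd h h0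
    obtain ⟨s, rfl⟩ := hrange
    refine ⟨s, ?_, rfl⟩
    rw [SetLike.mem_coe, mem_vanishing]
    intro u hu
    obtain ⟨j, hj⟩ := hπ.cover u
    rw [notMem_splitSet_iff hπ hj] at hu
    have hij : i ≤ j := hu.elim le_of_lt fun h => h.1.le
    rw [← hnet.comp_eq_zero_iff hγ (hF.between_of_mem hQ hγ hij hj)]
    refine hc j u hj fun h => ?_
    subst h
    exact hu.elim (fun h => absurd h (lt_irrefl _)) fun h => h.2

/-- The `i`-th summand of the splitting is the difference of the dimensions of a step of the
filtration of `V v` and of the kernel of the map to `V (w i)`. -/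
lemma IsFlagPolygon.splitting_eq [∀ v, FiniteDimensional k (V v)]
    (hF : IsFlagPolygon ty γ v π (typeFlag ty γ v π) w)
    (hnet : IsLinkedNet φ ty) (hQ : IsZnQuiver ty)
    (hγ : ∀ u v, Admissible ty (γ u v)) (hfin : H.Finite) (hπ : IsOrderedPartition π) (hv : v ∈ H)
    (I : Set H) :
    splitting (subspaceFun (vertexSpace φ γ H v)) π I =
      ∑ i, (Module.finrank k (blockSpace φ γ v π w I i) : ℝ) := by
  refine Finset.sum_congr rfl fun i _ => ?_
  have hker : vanishing φ γ v (⋃ j < i, π j) = LinearMap.ker (pathMap φ (γ v (w i))) := by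
    ext s
    rw [mem_vanishing, LinearMap.mem_ker, hF.apply_eq_zero_iff hnet hQ hγ hfin hπ]
    simp only [Set.mem_iUnion, exists_prop, not_exists, not_and]
    constructor
    · exact fun h j hj u hu => h u fun l hl hul => (hl.trans_le hj).ne (hπ.index_eq hul hu)
    · intro h u hu
      obtain ⟨j, hj⟩ := hπ.cover u
      exact h j (not_lt.1 fun hlt => hu j hlt hj) u hj
  have hle : LinearMap.ker (pathMap φ (γ v (w i))) ≤ vanishing φ γ v (splitSet π I i) := by
    rw [← hker]
    intro s hs
    rw [mem_vanishing] at hs ⊢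
    exact fun u hu => hs u fun h => hu (Or.inr h)
  have := finrank_eq_finrank_map_add _ hle
  rw [minorFun, subspaceFun_vertexSpace hnet hγ hv, subspaceFun_vertexSpace hnet hγ hv, hker]
  change (Module.finrank k (vanishing φ γ v (splitSet π I i)) : ℝ) - _ = _
  rw [this]
  push_cast
  exact add_sub_cancel_right _ _

/-- The part of `W_Δ` supported on `I` is the direct sum of the block spaces. -/
lemma IsFlagPolygon.subspaceFun_polygonSpace [∀ v, FiniteDimensional k (V v)]
    (hF : IsFlagPolygon ty γ v π (typeFlag ty γ v π) w)
    (hnet : IsLinkedNet φ ty) (hexact : IsExact φ ty) (hQ : IsZnQuiver ty)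
    (hγ : ∀ u v, Admissible ty (γ u v)) (hπ : IsOrderedPartition π) (hv : v ∈ H)
    (hfirst : ∀ i : Fin m, (i : ℕ) = 0 → ⟨v, hv⟩ ∈ π i) (hw : ∀ i, w i ∈ H)
    {Δ : Finset Q} (hΔ : (Δ : Set Q) = Set.range w) (I : Set H) :
    subspaceFun (polygonSpace φ ty γ H Δ) I =
      ∑ i, (Module.finrank k (blockSpace φ γ v π w I i) : ℝ) := by
  classical
  choose idx hidx using hπ.cover
  have hidx_eq : ∀ {i u}, u ∈ π i → idx u = i := fun hu => hπ.index_eq (hidx _) hu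
  have hshadow : ∀ u : H, shadow ty (Δ : Set Q) u = w (idx u) := fun u => by
    rw [hΔ]
    exact shadow_eq hQ hγ (hF.isShadow hQ hγ hπ (hidx u))
  have hregion : ∀ i (u : H), (u : Q) ∈ shadowRegion ty (Δ : Set Q) (w i) ↔ u ∈ π i := fun i u => by
    rw [hΔ]
    exact hF.mem_shadowRegion_iff hQ hγ hπ
  have hmem := hF.mem_blockSpace_iff hnet hexact hQ hγ hπ hv hfirst I
  have hpoly : ∀ (s : ∀ x : Q, V x) (u : H),
      polygonMap φ ty γ H Δ s u = pathMap φ (γ (w (idx u)) u) (s (w (idx u))) := fun s u =>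
    congrArg (fun x => pathMap φ (γ x u) (s x)) (hshadow u)
  let Θ : (∀ i, blockSpace φ γ v π w I i) →ₗ[k] (∀ u : H, V u) :=
    LinearMap.pi fun u => (pathMap φ (γ (w (idx u)) u)).comp
      ((blockSpace φ γ v π w I (idx u)).subtype.comp (LinearMap.proj (idx u)))
  have hΘ : ∀ c u, Θ c u = pathMap φ (γ (w (idx u)) u) (c (idx u)) := fun _ _ => rfl
  -- The component at `w i ∈ H`, whose shadow is itself, recovers the `i`-th vector.
  have hself : ∀ i, idx ⟨w i, hw i⟩ = i := fun i => by
    refine hidx_eq ((hregion i _).1 ?_)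
    refine (isShadow_iff hQ hγ).2 ⟨hΔ ▸ Set.mem_range_self i, fun z _ => ?_⟩
    obtain ⟨a, ha⟩ := hγ z (w i)
    exact ⟨a, ha, typeVec_self hQ hγ _ a⟩
  have hinj : Function.Injective Θ := by
    rw [injective_iff_map_eq_zero]
    intro c hc
    ext i
    have h := congrFun hc ⟨w i, hw i⟩
    rw [hΘ, hself] at h
    exact hnet.self_eq_zero hγ h
  have hrange : polygonSpace φ ty γ H Δ ⊓ (⨅ u ∈ Iᶜ, LinearMap.ker (LinearMap.proj u)) =
      LinearMap.range Θ := by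
    ext y
    simp only [Submodule.mem_inf, Submodule.mem_iInf, LinearMap.mem_ker, LinearMap.proj_apply,
      LinearMap.mem_range, polygonSpace, Submodule.mem_map, Set.mem_compl_iff]
    constructor
    · rintro ⟨⟨s, hs, rfl⟩, hI⟩
      refine ⟨fun i => ⟨s (w i), (hmem i _).2 fun j u hu hj => ?_⟩, ?_⟩
      · by_cases hji : j = i
        · subst hji
          have h := hI u (hj rfl)
          rwa [hpoly, hidx_eq hu] at h
        · have hwΔ : w i ∈ Δ := by
            rw [← Finset.mem_coe, hΔ]
            exact Set.mem_range_self i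
          exact hs.2 (w i) hwΔ u u.2 fun h => hji (hπ.index_eq hu ((hregion i u).1 h))
      · ext u
        rw [hΘ, hpoly]
    · rintro ⟨c, rfl⟩
      let s : ∀ x : Q, V x := ∑ i, Pi.single (w i) (c i : V (w i))
      have hs : ∀ i, s (w i) = c i := fun i => by
        simp only [s, Finset.sum_apply]
        rw [Finset.sum_eq_single i, Pi.single_eq_same]
        · exact fun j _ hj => Pi.single_eq_of_ne ((hF.injective hπ).ne hj.symm) _
        · simp
      refine ⟨⟨s, ⟨fun x hx => ?_, fun x hx y hy hxy => ?_⟩, ?_⟩, fun u hu => ?_⟩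
      · simp only [s, Finset.sum_apply]
        refine Finset.sum_eq_zero fun i _ => Pi.single_eq_of_ne ?_ _
        rintro rfl
        rw [← Finset.mem_coe, hΔ] at hx
        exact hx (Set.mem_range_self i)
      · rw [← Finset.mem_coe, hΔ] at hx
        obtain ⟨i, rfl⟩ := hx
        rw [hs]
        refine (hmem i _).1 (c i).2 _ ⟨y, hy⟩ (hidx _) fun h => ?_
        exact absurd ((hregion i ⟨y, hy⟩).2 (h ▸ hidx ⟨y, hy⟩)) hxy
      · ext u
        rw [hΘ, hpoly, hs]
      · rw [hΘ]
        exact (hmem _ _).1 (c (idx u)).2 _ u (hidx u) fun _ => hu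
  rw [subspaceFun, hrange, LinearMap.finrank_range_of_inj hinj, Module.finrank_pi_fintype]
  push_cast
  rfl

end Face

end LinkedNet

theorem proposition3p6 {k : Type*} [Field k] {n : ℕ} {Q : Type*} [Quiver Q]
    (ty : ∀ ⦃u v : Q⦄, (u ⟶ v) → Fin (n + 1)) (hQ : LinkedNet.IsZnQuiver ty)
    (V : Q → Type*) [∀ v, AddCommGroup (V v)] [∀ v, Module k (V v)]
    [∀ v, FiniteDimensional k (V v)]
    (φ : ∀ ⦃u v : Q⦄, (u ⟶ v) → V u →ₗ[k] V v)
    (hnet : LinkedNet.IsLinkedNet φ ty) (hexact : LinkedNet.IsExact φ ty)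
    (hfg : LinkedNet.FinitelyGenerated φ) (hnontrivial : ∃ u, Nontrivial (V u))
    (γ : ∀ u v : Q, Quiver.Path u v) (hγ : ∀ u v, LinkedNet.Admissible ty (γ u v))
    (H : Set Q) (hH : H = LinkedNet.minGenerators φ)
    (v : Q) (hv : v ∈ H) (r : ℕ) (hr : Module.finrank k (V v) = r + 1)
    (m : ℕ) (π : Fin m → Set H) (hπ : LinkedNet.IsOrderedPartition π)
    (hmeet : (LinkedNet.vertexFace φ γ H v π ∩
      LinkedNet.relInterior (LinkedNet.simplex H ((r : ℝ) + 1))).Nonempty) :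
    ∃ Δ : Finset Q, LinkedNet.IsGon ty m Δ ∧ (Δ : Set Q) ⊆ H ∧ v ∈ Δ ∧
      LinkedNet.IsInducedPartition ty Δ v H π ∧
      LinkedNet.vertexFace φ γ H v π = LinkedNet.polygonPolytope φ ty γ H Δ := by
  classical
  subst hH
  have hfin := hnet.minGenerators_finite hQ hγ hfg hnontrivial
  have hsep : LinkedNet.Separates φ γ v π := fun i u hu =>
    LinkedNet.exists_apply_ne_zero hnet hγ hv hπ (by positivity) hmeet i u hu
  obtain ⟨w, hF⟩ := hsep.exists_isFlagPolygon hnet hQ hγ hfin hπ hv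
  have hfirst : ∀ i : Fin m, (i : ℕ) = 0 → ⟨v, hv⟩ ∈ π i := fun i hi =>
    hsep.mem_first hnet hγ hπ hv hi
  have hw := hF.mem_minGenerators hnet hexact hQ hγ hfg hπ hfin hsep
  have hinj := hF.injective hπ
  obtain ⟨i₀, -⟩ := hπ.cover ⟨v, hv⟩
  have hm : 0 < m := i₀.pos
  have hw₀ : w ⟨0, hm⟩ = v := hF.first_eq hQ hγ rfl
  have hΔ : ((Finset.univ.image w : Finset Q) : Set Q) = Set.range w := by simp
  refine ⟨Finset.univ.image w, ⟨⟨⟨v, ?_⟩, ?_⟩, ?_⟩, ?_, ?_,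
    ⟨w, hF.isOrientedGon hQ hγ hπ, hΔ.symm, hinj, ⟨hm, hw₀⟩, fun i => ?_⟩, ?_⟩
  · exact Finset.mem_image.2 ⟨_, Finset.mem_univ _, hw₀⟩
  · intro x hx y hy hxy
    obtain ⟨i, -, rfl⟩ := Finset.mem_image.1 hx
    obtain ⟨j, -, rfl⟩ := Finset.mem_image.1 hy
    exact hF.neighbor hQ hγ hπ fun h => hxy (h ▸ rfl)
  · rw [Finset.card_image_of_injective _ hinj, Finset.card_fin]
  · rw [hΔ]
    rintro _ ⟨i, rfl⟩
    exact hw i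
  · exact Finset.mem_image.2 ⟨_, Finset.mem_univ _, hw₀⟩
  · ext u
    rw [hΔ]
    exact (hF.mem_shadowRegion_iff hQ hγ hπ).symm
  · rw [LinkedNet.vertexFace, LinkedNet.polygonPolytope]
    congr 1
    ext I
    rw [hF.splitting_eq hnet hQ hγ hfin hπ hv,
      hF.subspaceFun_polygonSpace hnet hexact hQ hγ hπ hv hfirst hw hΔ]
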